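/- Let $M$ be a connected smooth manifold of dimension $m\ge 1$ (Hausdorff, second countable) and let $g$ be a smooth Riemannian or pseudo-Riemannian metric on $M$, of any signature. Put $H(x,p)=\tfrac12 g^{ij}(x)p_ip_j$ on $T^*M$, and let $\{\cdot,\cdot\}$ be the canonical Poisson bracket. For integers $r,s\ge 0$ let $\mathcal R_{m,r,s}(g)$ be the (nonlinear) space of rational integrals of bidegree $(r,s)$ of the geodesic flow. These are the fractions $$F(x,p)=\frac{P(x,p)}{Q(x,p)}=\frac{P^{i_1\dots i_r}(x)\,p_{i_1}\cdots p_{i_r}}{Q^{i_1\dots i_s}(x)\,p_{i_1}\cdots p_{i_s}}$$ such that $P,Q$ are smooth on $T^*M$ and homogeneous polynomials of degrees $r$ and $s$ in the momenta $p$; for $x$ in a dense subset of $M$ the polynomial $Q(x,\cdot)$ is nonzero and $P(x,\cdot)$, $Q(x,\cdot)$ are relatively prime; for no $x\in M$ do $P(x,\cdot)$ and $Q(x,\cdot)$ both vanish identically; and $\{H,F\}=0$ wherever $Q\neq0$. Two fractions $P/Q$ and $P'/Q'$ are identified if $PQ'=P'Q$, and $\mathcal R_{m,r,s}(g)$ carries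 the quotient of the topology of pointwise convergence of $(P,Q)$ on $T^*M$. Then $\mathcal R_{m,r,s}(g)$ is finite-dimensional, of dimension at most $n^2$, where $$n=\binom{r+m-1}{r}+\binom{s+m-1}{s}-1 .$$ That is, every $F_0\in\mathcal R_{m,r,s}(g)$ has an open neighbourhood in $\mathcal R_{m,r,s}(g)$ that admits a continuous injection into $\mathbb R^{n^2}$. -/

import Mathlib

open scoped ContDiff Manifold

noncomputable section

section Geometry

variable (m : ℕ) (M : Type*) [TopologicalSpace M] [ChartedSpace (EuclideanSpace ℝ (Fin m)) M]

/-- A smooth pseudo-Riemannian metric on an `m`-dimensional manifold: a smooth field of symmetric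
nondegenerate bilinear forms on the tangent spaces, of any signature.  (Compare
`Bundle.ContMDiffRiemannianMetric`, where nondegeneracy is replaced by positivity.) -/
structure PseudoRiemannianMetric [IsManifold (𝓡 m) ∞ M] where
  /-- the bilinear form on each tangent space -/
  form : ∀ x : M, TangentSpace (𝓡 m) x →L[ℝ] TangentSpace (𝓡 m) x →L[ℝ] ℝ
  symm : ∀ (x : M) (v w : TangentSpace (𝓡 m) x), form x v w = form x w v
  nondegenerate : ∀ (x : M) (v : TangentSpace (𝓡 m) x), (∀ w, form x v w = 0) → v = 0
  contMDiff : ContMDiff (𝓡 m)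
    ((𝓡 m).prod 𝓘(ℝ, EuclideanSpace ℝ (Fin m) →L[ℝ] EuclideanSpace ℝ (Fin m) →L[ℝ] ℝ)) ∞
    (fun x : M ↦ Bundle.TotalSpace.mk'
      (EuclideanSpace ℝ (Fin m) →L[ℝ] EuclideanSpace ℝ (Fin m) →L[ℝ] ℝ) x (form x))

variable {m M}

/-- The cotangent space `T*_x M`; its elements are the momenta at `x`. -/
abbrev Covector (x : M) : Type := TangentSpace (𝓡 m) x →L[ℝ] ℝ

/-- The covector `∑ i, ξ i dyⁱ` at the point with coordinates `y` in the chart `e`. -/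
def coordCovector (e : OpenPartialHomeomorph M (EuclideanSpace ℝ (Fin m)))
    (y ξ : EuclideanSpace ℝ (Fin m)) : Covector (m := m) (e.symm y) :=
  (innerSL ℝ ξ : EuclideanSpace ℝ (Fin m) →L[ℝ] ℝ).comp
    (mfderiv (𝓡 m) (𝓡 m) e (e.symm y))

/-- The expression of a function on `T*M` in the canonical coordinates `(y, ξ)` (positions and
momenta) of `T*M` that belong to the chart `e` of `M`. -/
def inCoords (F : (x : M) → Covector (m := m) x → ℝ)
    (e : OpenPartialHomeomorph M (EuclideanSpace ℝ (Fin m))) :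
    EuclideanSpace ℝ (Fin m) × EuclideanSpace ℝ (Fin m) → ℝ :=
  fun z ↦ F (e.symm z.1) (coordCovector e z.1 z.2)

/-- The canonical Poisson bracket
`{f, h} = ∑ i, (∂f/∂ξᵢ ∂h/∂yⁱ - ∂f/∂yⁱ ∂h/∂ξᵢ)` of functions of positions and momenta. -/
def poissonBracket (f h : EuclideanSpace ℝ (Fin m) × EuclideanSpace ℝ (Fin m) → ℝ)
    (z : EuclideanSpace ℝ (Fin m) × EuclideanSpace ℝ (Fin m)) : ℝ :=
  ∑ i : Fin m,
    (fderiv ℝ f z (0, EuclideanSpace.single i 1) * fderiv ℝ h z (EuclideanSpace.single i 1, 0)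
      - fderiv ℝ f z (EuclideanSpace.single i 1, 0) * fderiv ℝ h z (0, EuclideanSpace.single i 1))

/-- The Hamiltonian `H(x, p) = ½ gⁱʲ(x) pᵢ pⱼ` of the geodesic flow: half of the value of `p` on
the vector `g⁻¹ p` that `g` pairs with `p`. -/
def PseudoRiemannianMetric.hamiltonian [IsManifold (𝓡 m) ∞ M] (g : PseudoRiemannianMetric m M)
    (x : M) (p : Covector (m := m) x) : ℝ :=
  1 / 2 * p ((g.form x).inverse p)

/-- The components of a covector with respect to the basis of `T_x M` by which Mathlib identifies
`T_x M` with `ℝᵐ`. -/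
def components (x : M) (p : Covector (m := m) x) (i : Fin m) : ℝ :=
  p (show TangentSpace (𝓡 m) x from (EuclideanSpace.single i (1 : ℝ) : EuclideanSpace ℝ (Fin m)))

variable (m M) in
/-- A function on `T*M` that on each cotangent space is a homogeneous polynomial of degree `d` in
the momenta, and that is smooth on `T*M` (equivalently, has smooth coefficients). -/
structure MomentumPoly (d : ℕ) where
  /-- the polynomial on `T*_x M`, written in the components of the momentum -/
  poly : M → MvPolynomial (Fin m) ℝ
  homogeneous : ∀ x, (poly x).IsHomogeneous d
  smooth : ∀ e ∈ atlas (EuclideanSpace ℝ (Fin m)) M,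
    ContDiffOn ℝ ∞ (inCoords (fun x p ↦ MvPolynomial.eval (components x p) (poly x)) e)
      (e.target ×ˢ Set.univ)

/-- The function on `T*M` given by a polynomial in the momenta. -/
def MomentumPoly.toFun {d : ℕ} (P : MomentumPoly m M d) (x : M) (p : Covector (m := m) x) : ℝ :=
  MvPolynomial.eval (components x p) (P.poly x)

/-- A representation `P / Q` of a rational integral of bidegree `(r, s)` of the geodesic flow:
`P` and `Q` are homogeneous of degrees `r` and `s` in the momenta, relatively prime as polynomials
in the momenta over a dense set of points `x`, with no point over which both vanish identically,
and `{H, P / Q} = 0` wherever `Q` does not vanish. -/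
structure IntegralFraction [IsManifold (𝓡 m) ∞ M] (g : PseudoRiemannianMetric m M) (r s : ℕ) where
  num : MomentumPoly m M r
  den : MomentumPoly m M s
  relPrime : Dense {x | den.poly x ≠ 0 ∧ IsRelPrime (num.poly x) (den.poly x)}
  not_both_zero : ∀ x, num.poly x ≠ 0 ∨ den.poly x ≠ 0
  involution : ∀ e ∈ atlas (EuclideanSpace ℝ (Fin m)) M, ∀ y ∈ e.target,
    ∀ ξ : EuclideanSpace ℝ (Fin m), inCoords den.toFun e (y, ξ) ≠ 0 →
      poissonBracket (inCoords g.hamiltonian e)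
        (inCoords (fun x p ↦ num.toFun x p / den.toFun x p) e) (y, ξ) = 0

variable [IsManifold (𝓡 m) ∞ M] (g : PseudoRiemannianMetric m M) (r s : ℕ)

/-- The topology of pointwise convergence of numerators and denominators on `T*M`. -/
instance IntegralFraction.instTopologicalSpace : TopologicalSpace (IntegralFraction g r s) :=
  TopologicalSpace.induced
    (fun F (z : Σ x : M, Covector (m := m) x) ↦ (F.num.toFun z.1 z.2, F.den.toFun z.1 z.2))
    inferInstance

/-- Two representations `P / Q` and `P' / Q'` define the same rational integral when
`P Q' = P' Q`. -/
instance IntegralFraction.instSetoid : Setoid (IntegralFraction g r s) where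
  r F G := ∀ x, F.num.poly x * G.den.poly x = G.num.poly x * F.den.poly x
  iseqv :=
    { refl := fun _ _ ↦ rfl
      symm := fun h x ↦ (h x).symm
      trans := by
        intro F G K h₁ h₂ x
        have e₁ := h₁ x
        have e₂ := h₂ x
        rcases G.not_both_zero x with h | h
        · apply mul_left_cancel₀ h
          linear_combination F.num.poly x * e₂ + K.num.poly x * e₁
        · apply mul_left_cancel₀ h
          linear_combination K.den.poly x * e₁ + F.den.poly x * e₂ }

/-- The (nonlinear) space of rational integrals of bidegree `(r, s)` of the geodesic flow of `g`,
with the quotient of the topology of pointwise convergence of numerators and denominators. -/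
def RationalIntegrals : Type _ := Quotient (IntegralFraction.instSetoid g r s)

instance RationalIntegrals.instTopologicalSpace : TopologicalSpace (RationalIntegrals g r s) :=
  inferInstanceAs (TopologicalSpace (Quotient (IntegralFraction.instSetoid g r s)))

end Geometry

/-- A (nonlinear) space `X` is finite-dimensional, of dimension at most `N`, if near each of its
points its elements are distinguished by `N` real parameters that depend continuously on the
element: each point has an open neighbourhood with a continuous injection into `ℝᴺ`.  (By
invariance of domain, `X` then contains no continuous injective family with more than `N`
parameters.) -/
def DimensionAtMost (X : Type*) [TopologicalSpace X] (N : ℕ) : Prop :=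
  ∀ a : X, ∃ U : Set X, IsOpen U ∧ a ∈ U ∧
    ∃ f : X → EuclideanSpace ℝ (Fin N), ContinuousOn f U ∧ Set.InjOn f U

end

noncomputable section

open Set Metric Topology
open scoped NNReal

local notation "𝔼" m:max => EuclideanSpace ℝ (Fin m)

/-! A pair of homogeneous polynomials of degrees $r$ and $s$ has $n+1$ coefficients, so over one
position a fraction, being defined up to a factor, has $n$ parameters. If it is in lowest terms, $n$
suitable momenta exist at which its values determine it (`IsCoprimeFiber.exists_isTestFamily`,
`IsTestFamily.exists_eq_mul`).

First integrals carry such information along geodesics. From $\{H,P\}Q=P\{H,Q\}$ and coprimality,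
$\{H,P\}=lP$ and $\{H,Q\}=lQ$ with one $l$ linear in the momenta. This passes to the positions where
$P$ and $Q$ are not coprime, because $l$ stays bounded where $P$ and $Q$ do not both vanish
identically (`exists_isLogDeriv`). Hence for two integrals $D=PQ'-P'Q$ satisfies a linear
homogeneous equation $\dot D=aD$ along each integral curve, even through zeros of the denominators,
and $D=0$ at one end forces $D=0$ at the other (`cross_eq_of_integralCurve`).

Now fix $y_0$ with a test family $p_1,\dots,p_n$, and let $y_k$ be the end position of the short
geodesic that starts at $(y_0,p_k)$. Suppose that two integrals share $n$ test values over each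
$y_k$, hence $n^2$ values in all. They then agree over each $y_k$, so at each $(y_0,p_k)$, so over
$y_0$. From $y$ near $y_0$ the same $y_k$ are reached with momenta near the $p_k$
(`exists_local_shooting`), which still form a test family; so the integrals agree near $y_0$
(`exists_determining_values`). Shooting into an open set of agreement extends it to the connected
manifold (`equiv_of_agree_on_isOpen`). Nonvanishing of the denominators and independence of the test
conditions are open conditions, so the $n^2$ values are continuous and injective near a given
integral. -/

/-! ### Short integral curves and local shooting -/

/-- Picard–Lindelöf: a curve that starts within $a/2$ of the centre moves by at most $LT\le a/2$ and
cannot leave the ball of radius $a$. The proof uses the Picard fixed point itself, which records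
this confinement. -/
theorem exists_flow_mem_closedBall {Z : Type*} [NormedAddCommGroup Z] [NormedSpace ℝ Z]
    [CompleteSpace Z] {X : Z → Z} {z₀ : Z} {a L K : ℝ≥0} {T : ℝ} (hT : 0 ≤ T)
    (hb : ∀ z ∈ closedBall z₀ a, ‖X z‖ ≤ L) (hl : LipschitzOnWith K X (closedBall z₀ a))
    (hLT : L * T ≤ a / 2) :
    ∃ γ : Z → ℝ → Z, ∀ z ∈ closedBall z₀ (a / 2 : ℝ), γ z 0 = z ∧ ∀ t ∈ Icc 0 T,
      γ z t ∈ closedBall z₀ a ∧ HasDerivWithinAt (γ z) (X (γ z t)) (Icc 0 T) t := by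
  have hpl : IsPicardLindelof (fun _ ↦ X) (tmin := 0) (tmax := T) ⟨0, by simp [hT]⟩ z₀ a (a / 2)
      L K := by
    apply IsPicardLindelof.of_time_independent hb hl
    simp only [sub_zero, sub_self, max_eq_left hT, NNReal.coe_div, NNReal.coe_ofNat]
    linarith
  have key : ∀ z ∈ closedBall z₀ (a / 2 : ℝ), ∃ γ : ℝ → Z, γ 0 = z ∧ ∀ t ∈ Icc 0 T,
      γ t ∈ closedBall z₀ a ∧ HasDerivWithinAt γ (X (γ t)) (Icc 0 T) t := by
    intro z hz
    have hz' : z ∈ closedBall z₀ ((a / 2 : ℝ≥0) : ℝ) := by simpa using hz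
    obtain ⟨α, hα⟩ := ODE.FunSpace.exists_isFixedPt_next hpl hz'
    refine ⟨α.compProj, ?_, fun t ht ↦ ⟨α.compProj_mem_closedBall hpl.mul_max_le, ?_⟩⟩
    · have := ODE.FunSpace.compProj_val (α := α) (t := ⟨0, by simp [hT]⟩)
      rw [this, ← hα, ODE.FunSpace.next_apply₀]
    · apply ODE.hasDerivWithinAt_picard_Icc (t₀ := 0) (by simp [hT]) hpl.continuousOn_uncurry
        α.continuous_compProj.continuousOn (fun _ _ ↦ α.compProj_mem_closedBall hpl.mul_max_le)
        z ht |>.congr_of_mem _ ht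
      intro t ht
      rw [ODE.FunSpace.compProj_of_mem ht]
      nth_rw 1 [← hα]
      rw [ODE.FunSpace.next_apply]
  classical
  exact ⟨fun z ↦ if hz : z ∈ closedBall z₀ (a / 2 : ℝ) then (key z hz).choose else fun _ ↦ z,
    fun z hz ↦ by simpa only [dif_pos hz] using (key z hz).choose_spec⟩

section TwoCurves

variable {Z E : Type*} [NormedAddCommGroup Z] [NormedSpace ℝ Z] [NormedAddCommGroup E]
  [NormedSpace ℝ E]

/-- Grönwall's inequality for two trajectories of one Lipschitz field. -/
theorem dist_integralCurve_le {X : Z → Z} {s : Set Z} {K : ℝ≥0} {T : ℝ} {z z' : ℝ → Z}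
    (hl : LipschitzOnWith K X s)
    (hz : ∀ t ∈ Icc 0 T, z t ∈ s ∧ HasDerivWithinAt z (X (z t)) (Icc 0 T) t)
    (hz' : ∀ t ∈ Icc 0 T, z' t ∈ s ∧ HasDerivWithinAt z' (X (z' t)) (Icc 0 T) t) :
    ∀ t ∈ Icc 0 T, ‖z t - z' t‖ ≤ ‖z 0 - z' 0‖ * Real.exp (K * t) := by
  have aux : ∀ w : ℝ → Z, (∀ t ∈ Icc 0 T, w t ∈ s ∧ HasDerivWithinAt w (X (w t)) (Icc 0 T) t) →
      ∀ t ∈ Ico 0 T, HasDerivWithinAt w (X (w t)) (Ici t) t := fun w hw t ht ↦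
    ((hw t (Ico_subset_Icc_self ht)).2.mono (Icc_subset_Icc_left ht.1)).mono_of_mem_nhdsWithin
      (Icc_mem_nhdsGE ht.2)
  intro t ht
  have := dist_le_of_trajectories_ODE_of_mem (v := fun _ ↦ X) (s := fun _ ↦ s) (a := 0) (b := T)
    (δ := ‖z 0 - z' 0‖) (fun _ _ ↦ hl) (fun t ht ↦ (hz t ht).2.continuousWithinAt) (aux z hz)
    (fun t ht ↦ (hz t (Ico_subset_Icc_self ht)).1)
    (fun t ht ↦ (hz' t ht).2.continuousWithinAt) (aux z' hz')
    (fun t ht ↦ (hz' t (Ico_subset_Icc_self ht)).1) (dist_eq_norm _ _).le t ht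
  simpa [dist_eq_norm] using this

/-- A second-order estimate for the dependence on initial data of a component of an integral
curve. -/
theorem norm_component_sub_sub_le {X : Z → Z} {s : Set Z} {K K' : ℝ≥0} {T : ℝ} {z z' : ℝ → Z}
    (hT : 0 ≤ T) (hT1 : T ≤ 1) (π : Z →L[ℝ] E) {v' : Z → Z →L[ℝ] E}
    (hl : LipschitzOnWith K X s)
    (hv : ∀ z ∈ s, HasFDerivAt (fun z ↦ π (X z)) (v' z) z)
    (hl' : LipschitzOnWith K' (fun z ↦ v' z (X z)) s)
    (hz : ∀ t ∈ Icc 0 T, z t ∈ s ∧ HasDerivWithinAt z (X (z t)) (Icc 0 T) t)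
    (hz' : ∀ t ∈ Icc 0 T, z' t ∈ s ∧ HasDerivWithinAt z' (X (z' t)) (Icc 0 T) t) :
    ‖π (z T) - π (z' T) - (π (z 0) - π (z' 0)) - T • (π (X (z 0)) - π (X (z' 0)))‖
      ≤ K' * Real.exp K * T ^ 2 * ‖z 0 - z' 0‖ := by
  set C : ℝ := K' * Real.exp K * ‖z 0 - z' 0‖ with hC
  have hC0 : 0 ≤ C := by positivity
  -- The velocity of the component has derivative `v' z (X z)` along a curve. Its Lipschitz bound
  -- controls how fast the difference of velocities drifts; a second integration gives the factor
  -- $T^2$.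
  have h1 : ∀ t ∈ Icc 0 T, ‖(π (X (z t)) - π (X (z' t))) - (π (X (z 0)) - π (X (z' 0)))‖
      ≤ C * (t - 0) := by
    apply norm_image_sub_le_of_norm_deriv_le_segment'
      (f := fun t ↦ π (X (z t)) - π (X (z' t)))
      (f' := fun t ↦ v' (z t) (X (z t)) - v' (z' t) (X (z' t)))
    · intro t ht
      exact ((hv _ (hz t ht).1).comp_hasDerivWithinAt t (hz t ht).2).sub
        ((hv _ (hz' t ht).1).comp_hasDerivWithinAt t (hz' t ht).2)
    · intro t ht
      have ht' := Ico_subset_Icc_self ht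
      calc _ ≤ K' * ‖z t - z' t‖ := hl'.norm_sub_le (hz t ht').1 (hz' t ht').1
        _ ≤ K' * (‖z 0 - z' 0‖ * Real.exp (K * t)) := by
          gcongr
          exact dist_integralCurve_le hl hz hz' t ht'
        _ ≤ K' * (‖z 0 - z' 0‖ * Real.exp K) := by
          gcongr
          exact mul_le_of_le_one_right K.2 (ht'.2.trans hT1)
        _ = C := by rw [hC]; ring
  have h2 := norm_image_sub_le_of_norm_deriv_le_segment' (a := 0) (b := T) (C := C * T)
    (f := fun t ↦ π (z t) - π (z' t) - t • (π (X (z 0)) - π (X (z' 0))))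
    (f' := fun t ↦ π (X (z t)) - π (X (z' t)) - (1 : ℝ) • (π (X (z 0)) - π (X (z' 0))))
    (fun t ht ↦ ((π.hasFDerivAt.comp_hasDerivWithinAt t (hz t ht).2).sub
      (π.hasFDerivAt.comp_hasDerivWithinAt t (hz' t ht).2)).sub
        ((hasDerivWithinAt_id t _).smul_const _))
    (fun t ht ↦ by
      rw [one_smul]
      refine (h1 t (Ico_subset_Icc_self ht)).trans ?_
      rw [sub_zero]
      exact mul_le_mul_of_nonneg_left ht.2.le hC0) T ⟨hT, le_rfl⟩
  calc _ = _ := by congr 1; rw [zero_smul]; abel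
    _ ≤ C * T * (T - 0) := h2
    _ = _ := by rw [hC]; ring

end TwoCurves

/-- Short integral curves of a spray-like vector field on `E × E` (positions and momenta): near a
point `y₀` the positions that can be reached from `y` in time `T`, with small initial momentum,
fill a fixed neighbourhood of `y₀`, and the end position determines the initial momentum. -/
theorem exists_local_shooting {E : Type*} [NormedAddCommGroup E] [NormedSpace ℝ E]
    [CompleteSpace E] [Nontrivial E] {U : Set (E × E)} (hU : IsOpen U) {X : E × E → E × E}
    (hX : ContDiffOn ℝ ∞ X U) {G : E → E →L[ℝ] E} {y₀ : E} (h0 : (y₀, 0) ∈ U)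
    (hG : ContinuousAt G y₀) (hG0 : (G y₀).IsInvertible)
    (hXG : ∀ z ∈ U, (X z).1 = G z.1 z.2) (hX0 : ∀ y, (y, 0) ∈ U → X (y, 0) = 0) :
    ∃ (W : Set E) (a ρ C T : ℝ) (γ : E × E → ℝ → E × E),
      IsOpen W ∧ y₀ ∈ W ∧ 0 < ρ ∧ 0 ≤ T ∧ closedBall (y₀, 0) a ⊆ U ∧ W ⊆ closedBall y₀ a ∧
      (∀ y ∈ W, ∀ ξ ∈ ball (0 : E) ρ, γ (y, ξ) 0 = (y, ξ) ∧ ∀ t ∈ Icc 0 T,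
        γ (y, ξ) t ∈ closedBall (y₀, 0) a ∧
        HasDerivWithinAt (γ (y, ξ)) (X (γ (y, ξ) t)) (Icc 0 T) t) ∧
      (∀ y ∈ W, ∀ z ∈ W, ∃ ξ ∈ ball (0 : E) ρ, (γ (y, ξ) T).1 = z) ∧
      (∀ y ∈ W, ∀ ξ ∈ ball (0 : E) ρ, ∀ ξ' ∈ ball (0 : E) ρ,
        ‖ξ - ξ'‖ ≤ C * ‖(γ (y, ξ) T).1 - (γ (y, ξ') T).1‖) ∧
      (∀ y ∈ W, (γ (y, 0) T).1 = y) ∧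
      ContinuousOn (fun z ↦ γ z T) (W ×ˢ ball (0 : E) ρ) := by
  set z₀ : E × E := (y₀, 0)
  obtain ⟨G₀, hG₀⟩ := hG0
  have hUz : U ∈ 𝓝 z₀ := hU.mem_nhds h0
  have hXat : ContDiffAt ℝ ∞ X z₀ := hX.contDiffAt hUz
  set π := ContinuousLinearMap.fst ℝ E E
  have hπX : ContDiffOn ℝ ∞ (fun z ↦ π (X z)) U := π.contDiff.comp_contDiffOn hX
  -- This is the acceleration of the position component, whose Lipschitz constant enters the
  -- second-order estimate.
  have hw : ContDiffAt ℝ 1 (fun z ↦ fderiv ℝ (fun z ↦ π (X z)) z (X z)) z₀ := by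
    apply ContDiffAt.clm_apply _ (hXat.of_le (by norm_num))
    exact (hπX.contDiffAt hUz).fderiv_right (m := 1) (by norm_cast)
  obtain ⟨K, s, hs, hK⟩ := (hXat.of_le (m := 1) (by norm_num)).exists_lipschitzOnWith
  obtain ⟨K', s', hs', hK'⟩ := hw.exists_lipschitzOnWith
  set c : ℝ := ‖(G₀.symm : E →L[ℝ] E)‖⁻¹ with hc
  have hc0 : 0 < c := inv_pos.2 G₀.norm_symm_pos
  have hGn : ∀ᶠ y in 𝓝 y₀, ‖G y - G₀‖ < c / 4 := by
    have : Filter.Tendsto (fun y ↦ ‖G y - G₀‖) (𝓝 y₀) (𝓝 ‖G y₀ - G₀‖) :=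
      (hG.sub continuousAt_const).norm
    rw [← hG₀, sub_self, norm_zero] at this
    exact this.eventually (gt_mem_nhds (by positivity))
  obtain ⟨a₁, ha₁, hsub₁⟩ := Metric.nhds_basis_closedBall.mem_iff.1
    (Filter.inter_mem (Filter.inter_mem hs hs') hUz)
  obtain ⟨a₂, ha₂, hsub₂⟩ := Metric.nhds_basis_closedBall.mem_iff.1 hGn
  set a : ℝ≥0 := ⟨min a₁ a₂, (lt_min ha₁ ha₂).le⟩ with ha
  have ha0 : (0 : ℝ) < a := lt_min ha₁ ha₂
  have hball : closedBall z₀ a ⊆ s ∩ s' ∩ U :=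
    (closedBall_subset_closedBall (min_le_left _ _)).trans hsub₁
  have hGa : ∀ y ∈ closedBall y₀ (a : ℝ), ‖G y - G₀‖ ≤ c / 4 := fun y hy ↦
    le_of_lt (hsub₂ (closedBall_subset_closedBall (min_le_right _ _) hy))
  have hl : LipschitzOnWith K X (closedBall z₀ a) := hK.mono fun z hz ↦ (hball hz).1.1
  have hl' := hK'.mono (s := closedBall z₀ a) fun z hz ↦ (hball hz).1.2
  have hXz : X z₀ = 0 := hX0 _ h0
  -- The field vanishes at the centre, so its Lipschitz constant also bounds the speed, by $Ka$. The
  -- confinement condition $KaT\le a/2$ then restricts $T$ independently of $a$.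
  have hb : ∀ z ∈ closedBall z₀ (a : ℝ), ‖X z‖ ≤ (K * a : ℝ≥0) := by
    intro z hz
    have := hl.norm_sub_le hz (mem_closedBall_self a.2)
    rw [hXz, sub_zero] at this
    exact this.trans (by push_cast; gcongr; exact mem_closedBall_iff_norm.1 hz)
  set C₁ : ℝ := K' * Real.exp K with hC₁
  have hC₁0 : 0 ≤ C₁ := by positivity
  -- The first bound gives $KT\le 1/2$ for confinement and $T\le 1$. The second gives $C_1T\le c/4$:
  -- with the error $c/4$ from replacing `G y` by `G₀`, the total is $c/2$, below
  -- $c=\|G_0^{-1}\|^{-1}$.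
  set T : ℝ := min (1 / (2 * (K + 1))) (c / (4 * (C₁ + 1))) with hT
  have hK0 : (0 : ℝ) ≤ K := K.2
  have hT0 : 0 < T := lt_min (by positivity) (by positivity)
  have hTK : K * T ≤ 1 / 2 := by
    have : T ≤ 1 / (2 * (K + 1)) := min_le_left _ _
    rw [le_div_iff₀ (by positivity)] at this
    nlinarith
  have hT1 : T ≤ 1 := by
    have : T ≤ 1 / (2 * (K + 1)) := min_le_left _ _
    rw [le_div_iff₀ (by positivity)] at this
    nlinarith
  have hTC : C₁ * T ≤ c / 4 := by
    have : T ≤ c / (4 * (C₁ + 1)) := min_le_right _ _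
    rw [le_div_iff₀ (by positivity)] at this
    nlinarith
  obtain ⟨γ, hγ⟩ := exists_flow_mem_closedBall (a := a) hT0.le hb hl (by
    push_cast
    nlinarith)
  set ρ : ℝ := a / 2 with hρ
  have hρ0 : 0 < ρ := by positivity
  -- Two points of `W` are closer than $T\cdot\frac c2\cdot\frac\rho2$, which after division by $T$
  -- is the radius of the ball that the quantitative inverse function theorem covers.
  set W : Set E := ball y₀ (min ρ (T * (c / 2 * (ρ / 2)) / 2)) with hW
  have hWmem : ∀ y ∈ W, ∀ ξ ∈ ball (0 : E) ρ, (y, ξ) ∈ closedBall z₀ (a / 2 : ℝ) := by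
    intro y hy ξ hξ
    rw [← closedBall_prod_same]
    exact ⟨ball_subset_closedBall (ball_subset_ball (min_le_left _ _) hy),
      ball_subset_closedBall hξ⟩
  have hTmem : T ∈ Icc 0 T := ⟨hT0.le, le_rfl⟩
  have hWa : W ⊆ closedBall y₀ a := fun y hy ↦ ball_subset_closedBall
    (ball_subset_ball ((min_le_left _ _).trans (by rw [hρ]; linarith)) hy)
  have hdist : ∀ z ∈ closedBall z₀ (a / 2 : ℝ), ∀ z' ∈ closedBall z₀ (a / 2 : ℝ),
      ‖γ z T - γ z' T‖ ≤ Real.exp (K * T) * ‖z - z'‖ := by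
    intro z hz z' hz'
    have := dist_integralCurve_le hl (hγ z hz).2 (hγ z' hz').2 T hTmem
    rwa [(hγ z hz).1, (hγ z' hz').1, mul_comm] at this
  have hzero : ∀ y ∈ W, (γ (y, 0) T).1 = y := by
    intro y hy
    have hm := hWmem y hy 0 (mem_ball_self hρ0)
    have hm' : (y, (0 : E)) ∈ closedBall z₀ (a : ℝ) :=
      closedBall_subset_closedBall (by linarith) hm
    have := dist_integralCurve_le (z' := fun _ ↦ (y, (0 : E))) hl (hγ _ hm).2
      (fun t _ ↦ ⟨hm', by
        rw [hX0 y (hball hm').2]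
        exact hasDerivWithinAt_const _ _ _⟩) T hTmem
    rw [(hγ _ hm).1, sub_self, norm_zero, zero_mul] at this
    rw [sub_eq_zero.1 (norm_le_zero_iff.1 this)]
  -- In time $T$ the position moves by about $T\,G(y)\xi$, so after rescaling by $T^{-1}$ the
  -- shooting map is `G₀` up to a Lipschitz error $c/2$. Surjectivity and the inverse Lipschitz
  -- bound both follow from this.
  have happ : ∀ y ∈ W, ApproximatesLinearOn (fun ξ ↦ T⁻¹ • (γ (y, ξ) T).1) (G₀ : E →L[ℝ] E)
      (ball 0 ρ) ⟨c / 2, by positivity⟩ := by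
    intro y hy ξ hξ ξ' hξ'
    have hm := hWmem y hy ξ hξ
    have hm' := hWmem y hy ξ' hξ'
    have h1 := norm_component_sub_sub_le hT0.le hT1 π hl
      (fun z hz ↦ (((hπX.contDiffAt (hU.mem_nhds (hball hz).2)).differentiableAt
        (by simp)).hasFDerivAt)) hl' (hγ _ hm).2 (hγ _ hm').2
    rw [(hγ _ hm).1, (hγ _ hm').1] at h1
    have hU' : ∀ z ∈ closedBall z₀ (a / 2 : ℝ), π (X z) = G z.1 z.2 := fun z hz ↦
      hXG z (hball (closedBall_subset_closedBall (by linarith) hz)).2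
    rw [hU' _ hm, hU' _ hm', Prod.mk_sub_mk, sub_self, Prod.norm_mk, norm_zero,
      max_eq_right (norm_nonneg _)] at h1
    simp only [π, ContinuousLinearMap.coe_fst', sub_self, sub_zero, ← map_sub] at h1
    set d := (γ (y, ξ) T).1 - (γ (y, ξ') T).1
    have h2 : ‖T • ((G y - G₀) (ξ - ξ'))‖ ≤ T * (c / 4 * ‖ξ - ξ'‖) := by
      rw [norm_smul, Real.norm_of_nonneg hT0.le]
      gcongr
      exact ((G y - G₀).le_opNorm _).trans (by gcongr; exact hGa y (hWa hy))
    have h3 : T⁻¹ • (γ (y, ξ) T).1 - T⁻¹ • (γ (y, ξ') T).1 - (G₀ : E →L[ℝ] E) (ξ - ξ')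
        = T⁻¹ • ((d - T • G y (ξ - ξ')) + T • ((G y - G₀) (ξ - ξ'))) := by
      rw [← smul_sub, smul_add, smul_sub T⁻¹ d, inv_smul_smul₀ hT0.ne', inv_smul_smul₀ hT0.ne',
        sub_apply]
      abel
    rw [h3, norm_smul, norm_inv, Real.norm_of_nonneg hT0.le, inv_mul_le_iff₀ hT0]
    refine (norm_add_le _ _).trans ((add_le_add h1 h2).trans ?_)
    show C₁ * T ^ 2 * ‖ξ - ξ'‖ + _ ≤ T * (c / 2 * ‖ξ - ξ'‖)
    have : (C₁ * T) * (T * ‖ξ - ξ'‖) ≤ c / 4 * (T * ‖ξ - ξ'‖) := by gcongr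
    linarith
  refine ⟨W, a, ρ, (c / 2)⁻¹ * T⁻¹, T, γ, isOpen_ball, mem_ball_self (by positivity), hρ0, hT0.le,
    fun z hz ↦ (hball hz).2, hWa, fun y hy ξ hξ ↦ hγ _ (hWmem y hy ξ hξ), ?_, ?_, hzero, ?_⟩
  · intro y hy z hz
    have := (happ y hy).surjOn_closedBall_of_nonlinearRightInverse
      G₀.toNonlinearRightInverse (ε := ρ / 2) (b := 0) (by positivity)
      (closedBall_subset_ball (by linarith))
    obtain ⟨ξ, hξ, h⟩ := this (a := T⁻¹ • z) (by
      rw [mem_closedBall, hzero y hy, dist_smul₀, norm_inv, Real.norm_of_nonneg hT0.le,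
        inv_mul_le_iff₀ hT0]
      have e : (((G₀.toNonlinearRightInverse).nnnorm : ℝ)⁻¹ - c / 2) = c / 2 := by
        have : ((G₀.toNonlinearRightInverse).nnnorm : ℝ)⁻¹ = c := rfl
        rw [this]; ring
      have e2 : dist z y ≤ T * (c / 2 * (ρ / 2)) := by
        have h1 := (mem_ball.1 hz).trans_le (min_le_right _ _)
        have h2 := (mem_ball.1 hy).trans_le (min_le_right _ _)
        have := dist_triangle_right z y y₀
        linarith
      exact e2.trans_eq (congrArg (fun u ↦ T * (u * (ρ / 2))) e.symm))
    refine ⟨ξ, closedBall_subset_ball (by linarith) hξ, ?_⟩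
    exact smul_right_injective E (inv_ne_zero hT0.ne') h
  · intro y hy ξ hξ ξ' hξ'
    have h1 : ‖T⁻¹ • (γ (y, ξ) T).1 - T⁻¹ • (γ (y, ξ') T).1 - G₀ (ξ - ξ')‖
        ≤ c / 2 * ‖ξ - ξ'‖ := happ y hy ξ hξ ξ' hξ'
    have h2 : c * ‖ξ - ξ'‖ ≤ ‖G₀ (ξ - ξ')‖ := by
      have := (G₀.symm : E →L[ℝ] E).le_opNorm (G₀ (ξ - ξ'))
      rw [ContinuousLinearEquiv.coe_coe, G₀.symm_apply_apply] at this
      rwa [hc, inv_mul_le_iff₀ G₀.norm_symm_pos]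
    rw [← smul_sub] at h1
    have h3 : ‖G₀ (ξ - ξ')‖ ≤ ‖T⁻¹ • ((γ (y, ξ) T).1 - (γ (y, ξ') T).1)‖ + c / 2 * ‖ξ - ξ'‖ := by
      rw [norm_sub_rev] at h1
      linarith [norm_le_norm_add_norm_sub (T⁻¹ • ((γ (y, ξ) T).1 - (γ (y, ξ') T).1))
        (G₀ (ξ - ξ')), norm_sub_rev (G₀ (ξ - ξ'))
          (T⁻¹ • ((γ (y, ξ) T).1 - (γ (y, ξ') T).1))]
    rw [norm_smul, norm_inv, Real.norm_of_nonneg hT0.le] at h3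
    rw [mul_assoc, ← div_eq_inv_mul, le_div_iff₀ (by positivity)]
    linarith
  · have : LipschitzOnWith ⟨Real.exp (K * T), (Real.exp_pos _).le⟩ (fun z ↦ γ z T)
        (W ×ˢ ball (0 : E) ρ) := by
      refine LipschitzOnWith.of_dist_le_mul fun z hz z' hz' ↦ ?_
      rw [dist_eq_norm, dist_eq_norm]
      exact hdist z (hWmem _ hz.1 _ hz.2) z' (hWmem _ hz'.1 _ hz'.2)
    exact this.continuousOn

/-! ### Polynomials in the momenta and their Poisson brackets -/

section MomentumPolynomials

variable {m : ℕ}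

/-- The value of a polynomial at a point of Euclidean space. -/
def evalAt (p : MvPolynomial (Fin m) ℝ) (ξ : (𝔼 m)) : ℝ := MvPolynomial.eval (fun i ↦ ξ i) p

theorem hasFDerivAt_evalAt (p : MvPolynomial (Fin m) ℝ) (ξ : (𝔼 m)) :
    HasFDerivAt (evalAt p) (∑ i, evalAt (MvPolynomial.pderiv i p) ξ •
      (EuclideanSpace.proj i : (𝔼 m) →L[ℝ] ℝ)) ξ := by
  induction p using MvPolynomial.induction_on with
  | C a =>
    have : (evalAt (MvPolynomial.C a) : (𝔼 m) → ℝ) = fun _ ↦ a := by ext; simp [evalAt]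
    rw [this]
    simpa [evalAt] using hasFDerivAt_const a ξ
  | add p q hp hq =>
    have : (evalAt (p + q) : (𝔼 m) → ℝ) = fun ξ ↦ evalAt p ξ + evalAt q ξ := by ext; simp [evalAt]
    rw [this]
    convert! hp.add hq using 1
    simp [evalAt, add_smul, Finset.sum_add_distrib]
  | mul_X p j hp =>
    have : (evalAt (p * MvPolynomial.X j) : (𝔼 m) → ℝ)
        = fun ξ ↦ evalAt p ξ * (EuclideanSpace.proj j : (𝔼 m) →L[ℝ] ℝ) ξ := by ext; simp [evalAt]
    rw [this]
    convert! hp.mul (EuclideanSpace.proj j : (𝔼 m) →L[ℝ] ℝ).hasFDerivAt using 1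
    ext v
    simp only [evalAt, Derivation.leibniz, MvPolynomial.pderiv_X, smul_eq_mul, map_add, map_mul,
      MvPolynomial.eval_X, FunLike.coe_add, FunLike.coe_smul, sum_apply,
      Pi.add_apply, Pi.smul_apply, add_mul, Finset.sum_add_distrib, Finset.mul_sum, mul_assoc]
    congr 1
    simp [Pi.single_apply, apply_ite, ite_mul]

theorem continuous_evalAt (p : MvPolynomial (Fin m) ℝ) : Continuous (evalAt p : (𝔼 m) → ℝ) :=
  continuous_iff_continuousAt.2 fun ξ ↦ (hasFDerivAt_evalAt p ξ).continuousAt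

theorem fderiv_evalAt_single (p : MvPolynomial (Fin m) ℝ) (ξ : (𝔼 m)) (i : Fin m) :
    fderiv ℝ (evalAt p) ξ (EuclideanSpace.single i 1) = evalAt (MvPolynomial.pderiv i p) ξ := by
  rw [(hasFDerivAt_evalAt p ξ).fderiv]
  simp

/-- An open set contains a box with infinite sides, on which a polynomial is determined by its
values. -/
theorem eq_zero_of_evalAt_eq_zero {p : MvPolynomial (Fin m) ℝ} {U : Set (𝔼 m)} (hU : IsOpen U)
    (hne : U.Nonempty) (h : ∀ ξ ∈ U, evalAt p ξ = 0) : p = 0 := by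
  obtain ⟨ξ, hξ⟩ := hne
  have hU' : IsOpen ((EuclideanSpace.equiv (Fin m) ℝ).symm ⁻¹' U) :=
    hU.preimage (EuclideanSpace.equiv (Fin m) ℝ).symm.continuous
  obtain ⟨ε, hε, hsub⟩ := Metric.isOpen_iff.1 hU' (EuclideanSpace.equiv (Fin m) ℝ ξ) (by simpa)
  refine MvPolynomial.funext_set (fun i ↦ ball (ξ i) ε) (fun i ↦ ?_) fun x hx ↦ ?_
  · rw [Real.ball_eq_Ioo]
    exact Ioo_infinite (by linarith)
  · rw [map_zero]
    refine h _ (hsub (a := x) ?_)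
    rw [ball_pi _ hε]
    exact hx

theorem evalAt_injective : Function.Injective (evalAt : MvPolynomial (Fin m) ℝ → (𝔼 m) → ℝ) := by
  intro p q h
  rw [← sub_eq_zero]
  refine eq_zero_of_evalAt_eq_zero isOpen_univ univ_nonempty fun ξ _ ↦ ?_
  have := congrFun h ξ
  simp only [evalAt, map_sub] at this ⊢
  rw [this, sub_self]

theorem exists_evalAt_ne_zero {p : MvPolynomial (Fin m) ℝ} (hp : p ≠ 0) {U : Set (𝔼 m)}
    (hU : IsOpen U) (hne : U.Nonempty) : ∃ ξ ∈ U, evalAt p ξ ≠ 0 := by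
  by_contra! h
  exact hp (eq_zero_of_evalAt_eq_zero hU hne h)

/-- Interpolation: homogeneous polynomials are recovered linearly from finitely many values. -/
theorem exists_interpolation (m d : ℕ) :
    ∃ (k : ℕ) (x : Fin k → EuclideanSpace ℝ (Fin m)) (b : Fin k → MvPolynomial (Fin m) ℝ),
      (∀ j, (b j).IsHomogeneous d) ∧ ∀ p : MvPolynomial (Fin m) ℝ, p.IsHomogeneous d → ∀ ξ,
        evalAt p ξ = ∑ j, evalAt p (x j) * evalAt (b j) ξ := by
  set V := MvPolynomial.homogeneousSubmodule (Fin m) ℝ d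
  have hfin : FiniteDimensional ℝ V :=
    Module.Finite.of_fg (MvPolynomial.homogeneousSubmodule_fg (σ := Fin m) (R := ℝ) d)
  let φ : EuclideanSpace ℝ (Fin m) → Module.Dual ℝ V := fun ξ ↦
    { toFun := fun p ↦ evalAt p.1 ξ
      map_add' := fun p q ↦ by simp [evalAt]
      map_smul' := fun c p ↦ by simp [evalAt, MvPolynomial.smul_eval] }
  -- Finitely many point evaluations span the same subspace of the dual as all of them, so they
  -- jointly separate homogeneous polynomials; a left inverse of the joint evaluation supplies the
  -- interpolating polynomials.
  obtain ⟨f, hf, hspan, -⟩ := Submodule.exists_fun_fin_finrank_span_eq ℝ (range φ)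
  choose x hx using hf
  let L : V →ₗ[ℝ] (Fin _ → ℝ) := LinearMap.pi f
  have hL : LinearMap.ker L = ⊥ := by
    rw [LinearMap.ker_eq_bot']
    intro p hp
    have h0 : ∀ ψ ∈ Submodule.span ℝ (range f), ψ p = 0 := by
      intro ψ hψ
      induction hψ using Submodule.span_induction with
      | mem ψ h => obtain ⟨j, rfl⟩ := h; exact congrFun hp j
      | zero => rfl
      | add _ _ _ _ h1 h2 => simp [h1, h2]
      | smul _ _ _ h => simp [h]
    rw [hspan] at h0
    refine Subtype.ext (evalAt_injective (funext fun ξ ↦ ?_))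
    refine (h0 (φ ξ) (Submodule.subset_span ⟨ξ, rfl⟩)).trans ?_
    simp [evalAt]
  obtain ⟨g, hg⟩ := L.exists_leftInverse_of_injective hL
  refine ⟨_, x, fun j ↦ (g (Pi.single j 1)).1, fun j ↦ (g (Pi.single j 1)).2, fun p hp ξ ↦ ?_⟩
  have h1 : g (L ⟨p, hp⟩) = ⟨p, hp⟩ := LinearMap.congr_fun hg _
  have h2 : L ⟨p, hp⟩ = ∑ j, evalAt p (x j) • Pi.single j (1 : ℝ) := by
    ext j
    have : L ⟨p, hp⟩ j = evalAt p (x j) := (LinearMap.congr_fun (hx j) _).symm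
    rw [this]
    simp [Pi.single_apply]
  rw [h2, map_sum] at h1
  have h3 := congrArg (φ ξ) h1
  rw [map_sum] at h3
  refine h3.symm.trans (Finset.sum_congr rfl fun j _ ↦ ?_)
  rw [map_smul, map_smul]
  rfl

/-- A function of positions `y ∈ Ω` and momenta that is smooth and is a homogeneous polynomial of
degree `d` in the momenta. -/
structure IsFiberPoly (Ω : Set (𝔼 m)) (d : ℕ) (f : (𝔼 m) × (𝔼 m) → ℝ) : Prop where
  contDiffOn : ContDiffOn ℝ ∞ f (Ω ×ˢ univ)
  exists_poly : ∀ y ∈ Ω, ∃ p : MvPolynomial (Fin m) ℝ, p.IsHomogeneous d ∧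
    ∀ ξ, f (y, ξ) = evalAt p ξ

namespace IsFiberPoly

variable {Ω : Set (𝔼 m)} {d : ℕ} {f : (𝔼 m) × (𝔼 m) → ℝ}

theorem differentiableAt (hf : IsFiberPoly Ω d f) (hΩ : IsOpen Ω) {y : (𝔼 m)} (hy : y ∈ Ω) (ξ : (𝔼 m)) :
    DifferentiableAt ℝ f (y, ξ) :=
  (hf.contDiffOn.contDiffAt ((hΩ.prod isOpen_univ).mem_nhds ⟨hy, mem_univ _⟩)).differentiableAt
    (by simp)

theorem continuousAt (hf : IsFiberPoly Ω d f) (hΩ : IsOpen Ω) {y : (𝔼 m)} (hy : y ∈ Ω) (ξ : (𝔼 m)) :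
    ContinuousAt f (y, ξ) :=
  (hf.differentiableAt hΩ hy ξ).continuousAt

theorem fderiv_momentum (hf : IsFiberPoly Ω d f) (hΩ : IsOpen Ω) {y : (𝔼 m)} (hy : y ∈ Ω)
    {p : MvPolynomial (Fin m) ℝ} (hp : ∀ ξ, f (y, ξ) = evalAt p ξ) (ξ : (𝔼 m)) (i : Fin m) :
    fderiv ℝ f (y, ξ) (0, EuclideanSpace.single i 1) = evalAt (MvPolynomial.pderiv i p) ξ := by
  have h := (hf.differentiableAt hΩ hy ξ).hasFDerivAt.comp ξ (hasFDerivAt_prodMk_right y ξ)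
  have e : (f ∘ fun ξ ↦ (y, ξ)) = evalAt p := funext hp
  rw [e] at h
  rw [← fderiv_evalAt_single, h.fderiv]
  simp

/-- Interpolation writes $f(y,\xi)=\sum_j f(y,x_j)b_j(\xi)$ with fixed polynomials $b_j$, so a
derivative in $y$ falls only on the coefficients. -/
theorem exists_fderiv_position (hf : IsFiberPoly Ω d f) (hΩ : IsOpen Ω) {y : (𝔼 m)} (hy : y ∈ Ω)
    (v : (𝔼 m)) : ∃ p : MvPolynomial (Fin m) ℝ, p.IsHomogeneous d ∧
      ∀ ξ, fderiv ℝ f (y, ξ) (v, 0) = evalAt p ξ := by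
  obtain ⟨k, x, b, hb, hint⟩ := exists_interpolation m d
  have hdec : ∀ y ∈ Ω, ∀ ξ, f (y, ξ) = ∑ j, f (y, x j) * evalAt (b j) ξ := by
    intro y hy ξ
    obtain ⟨p, hp, hpf⟩ := hf.exists_poly y hy
    simp only [hpf]
    exact hint p hp ξ
  have hd : ∀ ξ, HasFDerivAt (fun y ↦ f (y, ξ))
      ((fderiv ℝ f (y, ξ)).comp (ContinuousLinearMap.inl ℝ (𝔼 m) (𝔼 m))) y := fun ξ ↦
    (hf.differentiableAt hΩ hy ξ).hasFDerivAt.comp y (hasFDerivAt_prodMk_left y ξ)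
  refine ⟨∑ j, MvPolynomial.C (fderiv ℝ f (y, x j) (v, 0)) * b j,
    MvPolynomial.IsHomogeneous.sum _ _ _ fun j _ ↦ (hb j).C_mul _, fun ξ ↦ ?_⟩
  have h1 : HasFDerivAt (fun y ↦ f (y, ξ)) _ y :=
    (HasFDerivAt.fun_sum (u := Finset.univ) fun j _ ↦
      (hd (x j)).mul_const (evalAt (b j) ξ)).congr_of_eventuallyEq
        (Filter.eventually_of_mem (hΩ.mem_nhds hy) fun y hy ↦ hdec y hy ξ)
  have h2 := DFunLike.congr_fun ((hd ξ).unique h1) v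
  simp only [ContinuousLinearMap.comp_apply, ContinuousLinearMap.inl_apply] at h2
  rw [h2]
  simp [evalAt, mul_comm]

theorem exists_poissonBracket (hf : IsFiberPoly Ω d f) (hΩ : IsOpen Ω) {h : (𝔼 m) × (𝔼 m) → ℝ}
    (hh : IsFiberPoly Ω 2 h) {y : (𝔼 m)} (hy : y ∈ Ω) :
    ∃ p : MvPolynomial (Fin m) ℝ, p.IsHomogeneous (d + 1) ∧
      ∀ ξ, poissonBracket h f (y, ξ) = evalAt p ξ := by
  obtain ⟨p, hp, hpf⟩ := hf.exists_poly y hy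
  obtain ⟨q, hq, hqh⟩ := hh.exists_poly y hy
  choose p' hp' hp'f using fun i : Fin m ↦
    hf.exists_fderiv_position hΩ hy (EuclideanSpace.single i 1)
  choose q' hq' hq'h using fun i : Fin m ↦
    hh.exists_fderiv_position hΩ hy (EuclideanSpace.single i 1)
  refine ⟨∑ i, (MvPolynomial.pderiv i q * p' i - q' i * MvPolynomial.pderiv i p),
    MvPolynomial.IsHomogeneous.sum _ _ _ fun i _ ↦ ?_, fun ξ ↦ ?_⟩
  · apply MvPolynomial.IsHomogeneous.sub
    · rw [add_comm]
      exact (hq.pderiv (i := i)).mul (hp' i)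
    · rcases d with _ | d
      · have : MvPolynomial.pderiv i p = 0 := by
          rw [MvPolynomial.totalDegree_eq_zero_iff_eq_C.1
            ((MvPolynomial.totalDegree_zero_iff_isHomogeneous _).2 hp), MvPolynomial.pderiv_C]
        rw [this, mul_zero]
        exact MvPolynomial.isHomogeneous_zero _ _ _
      · have := (hq' i).mul (hp.pderiv (i := i))
        rwa [show 2 + (d + 1 - 1) = d + 1 + 1 by omega] at this
  · simp only [poissonBracket, hf.fderiv_momentum hΩ hy hpf, hh.fderiv_momentum hΩ hy hqh, hp'f,
      hq'h]
    simp [evalAt]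

end IsFiberPoly

/-- The Hamiltonian vector field of `h`. -/
def hamVec (h : (𝔼 m) × (𝔼 m) → ℝ) (z : (𝔼 m) × (𝔼 m)) : (𝔼 m) × (𝔼 m) :=
  (∑ i, fderiv ℝ h z (0, EuclideanSpace.single i 1) • EuclideanSpace.single i (1 : ℝ),
    -∑ i, fderiv ℝ h z (EuclideanSpace.single i 1, 0) • EuclideanSpace.single i (1 : ℝ))

theorem poissonBracket_eq_fderiv (h f : (𝔼 m) × (𝔼 m) → ℝ) (z : (𝔼 m) × (𝔼 m)) :
    poissonBracket h f z = fderiv ℝ f z (hamVec h z) := by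
  have : hamVec h z = ∑ i, (fderiv ℝ h z (0, EuclideanSpace.single i 1) •
      ((EuclideanSpace.single i (1 : ℝ), 0) : (𝔼 m) × (𝔼 m)) -
      fderiv ℝ h z (EuclideanSpace.single i 1, 0) •
        ((0, EuclideanSpace.single i (1 : ℝ)) : (𝔼 m) × (𝔼 m))) := by
    ext1
    · simp [hamVec, Prod.fst_sum]
    · simp [hamVec, Prod.snd_sum]
  rw [this, map_sum]
  simp only [map_sub, map_smul, smul_eq_mul]
  rfl

theorem contDiffOn_hamVec {Ω : Set (𝔼 m)} (hΩ : IsOpen Ω) {h : (𝔼 m) × (𝔼 m) → ℝ}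
    (hh : ContDiffOn ℝ ∞ h (Ω ×ˢ univ)) : ContDiffOn ℝ ∞ (hamVec h) (Ω ×ˢ univ) := by
  have hd : ContDiffOn ℝ ∞ (fderiv ℝ h) (Ω ×ˢ univ) :=
    hh.fderiv_of_isOpen (hΩ.prod isOpen_univ) (by simp)
  unfold hamVec
  apply ContDiffOn.prodMk
  · exact ContDiffOn.sum fun i _ ↦ (hd.clm_apply contDiffOn_const).smul contDiffOn_const
  · exact (ContDiffOn.sum fun i _ ↦ (hd.clm_apply contDiffOn_const).smul contDiffOn_const).neg

theorem continuousOn_poissonBracket {Ω : Set (𝔼 m)} (hΩ : IsOpen Ω) {h f : (𝔼 m) × (𝔼 m) → ℝ}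
    (hh : ContDiffOn ℝ ∞ h (Ω ×ˢ univ)) (hf : ContDiffOn ℝ ∞ f (Ω ×ˢ univ)) :
    ContinuousOn (poissonBracket h f) (Ω ×ˢ univ) := by
  have hd : ContDiffOn ℝ ∞ (fderiv ℝ f) (Ω ×ˢ univ) :=
    hf.fderiv_of_isOpen (hΩ.prod isOpen_univ) (by simp)
  simp only [funext (poissonBracket_eq_fderiv h f)]
  exact (hd.clm_apply (contDiffOn_hamVec hΩ hh)).continuousOn

end MomentumPolynomials

/-! ### First integrals in coordinates: logarithmic derivatives and transport along the flow -/

section LocalIntegrals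

variable {m : ℕ}

/-- Over the position `y` the functions `P` and `Q` are relatively prime homogeneous polynomials in
the momenta, and `Q` is nonzero. -/
def IsCoprimeFiber (r s : ℕ) (P Q : 𝔼 m × 𝔼 m → ℝ) (y : 𝔼 m) : Prop :=
  ∃ p q : MvPolynomial (Fin m) ℝ, p.IsHomogeneous r ∧ q.IsHomogeneous s ∧ q ≠ 0 ∧
    IsRelPrime p q ∧ (∀ ξ, P (y, ξ) = evalAt p ξ) ∧ ∀ ξ, Q (y, ξ) = evalAt q ξ

/-- A rational first integral `P / Q` of the Hamiltonian `h`, in canonical coordinates over `Ω`. -/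
structure IsLocalIntegral (Ω : Set (𝔼 m)) (h : 𝔼 m × 𝔼 m → ℝ) (r s : ℕ)
    (P Q : 𝔼 m × 𝔼 m → ℝ) : Prop where
  num : IsFiberPoly Ω r P
  den : IsFiberPoly Ω s Q
  coprime : Ω ⊆ closure {y | y ∈ Ω ∧ IsCoprimeFiber r s P Q y}
  not_both_zero : ∀ y ∈ Ω, ∃ ξ, P (y, ξ) ≠ 0 ∨ Q (y, ξ) ≠ 0
  bracket : ∀ y ∈ Ω, ∀ ξ, Q (y, ξ) ≠ 0 → poissonBracket h (fun z ↦ P z / Q z) (y, ξ) = 0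

theorem evalAt_mul (p q : MvPolynomial (Fin m) ℝ) (ξ : 𝔼 m) :
    evalAt (p * q) ξ = evalAt p ξ * evalAt q ξ := by simp [evalAt]

theorem evalAt_sub (p q : MvPolynomial (Fin m) ℝ) (ξ : 𝔼 m) :
    evalAt (p - q) ξ = evalAt p ξ - evalAt q ξ := by simp [evalAt]

theorem exists_inner_of_isHomogeneous_one {p : MvPolynomial (Fin m) ℝ} (hp : p.IsHomogeneous 1) :
    ∃ l : 𝔼 m, ∀ ξ, evalAt p ξ = inner ℝ l ξ := by
  have : p ∈ MvPolynomial.homogeneousSubmodule (Fin m) ℝ 1 := hp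
  rw [MvPolynomial.homogeneousSubmodule_one_eq_span_X] at this
  clear hp
  induction this using Submodule.span_induction with
  | mem p h =>
    obtain ⟨i, rfl⟩ := h
    exact ⟨EuclideanSpace.single i 1, fun ξ ↦ by simp [evalAt, EuclideanSpace.inner_single_left]⟩
  | zero => exact ⟨0, fun ξ ↦ by simp [evalAt]⟩
  | add p q hp hq h1 h2 =>
    obtain ⟨l, hl⟩ := h1
    obtain ⟨l', hl'⟩ := h2
    exact ⟨l + l', fun ξ ↦ by rw [inner_add_left, ← hl, ← hl']; simp [evalAt]⟩
  | smul c p hp h =>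
    obtain ⟨l, hl⟩ := h
    exact ⟨c • l, fun ξ ↦ by
      rw [inner_smul_left, ← hl]; simp [evalAt, MvPolynomial.smul_eval]⟩

/-- A homogeneous factor of a homogeneous polynomial has a homogeneous cofactor. -/
theorem exists_isHomogeneous_cofactor {q x l : MvPolynomial (Fin m) ℝ} {s d : ℕ}
    (hq : q.IsHomogeneous s) (hx : x.IsHomogeneous (s + d)) (h : x = q * l) :
    ∃ l' : MvPolynomial (Fin m) ℝ, l'.IsHomogeneous d ∧ x = q * l' := by
  let := MvPolynomial.gradedAlgebra (R := ℝ) (σ := Fin m)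
  refine ⟨_, (DirectSum.decompose (MvPolynomial.homogeneousSubmodule (Fin m) ℝ) l d).2, ?_⟩
  have h1 := DirectSum.coe_decompose_mul_add_of_left_mem
    (MvPolynomial.homogeneousSubmodule (Fin m) ℝ) (i := s) (j := d) (a := q) (b := l) hq
  rw [← h] at h1
  rw [DirectSum.decompose_of_mem_same _ (show x ∈ MvPolynomial.homogeneousSubmodule (Fin m) ℝ _
    from hx)] at h1
  exact h1

/-- `l` is the logarithmic derivative, over the position `y`, of both `P` and `Q` along the flow. -/
def IsLogDeriv (h P Q : 𝔼 m × 𝔼 m → ℝ) (y l : 𝔼 m) : Prop :=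
  ∀ ξ, poissonBracket h P (y, ξ) = inner ℝ l ξ * P (y, ξ) ∧
    poissonBracket h Q (y, ξ) = inner ℝ l ξ * Q (y, ξ)

namespace IsLocalIntegral

variable {Ω : Set (𝔼 m)} {h : 𝔼 m × 𝔼 m → ℝ} {r s : ℕ} {P Q : 𝔼 m × 𝔼 m → ℝ}

/-- This is the Leibniz rule for $P=(P/Q)\,Q$, valid near a point with $Q\ne0$, where the bracket of
$h$ with $P/Q$ vanishes. -/
theorem bracket_mul_eq (hPQ : IsLocalIntegral Ω h r s P Q) (hΩ : IsOpen Ω) {y : 𝔼 m} (hy : y ∈ Ω)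
    {ξ : 𝔼 m} (hQ : Q (y, ξ) ≠ 0) :
    poissonBracket h P (y, ξ) * Q (y, ξ) = P (y, ξ) * poissonBracket h Q (y, ξ) := by
  have h1 := hPQ.bracket y hy ξ hQ
  have hP' := hPQ.num.differentiableAt hΩ hy ξ
  have hQ' := hPQ.den.differentiableAt hΩ hy ξ
  have hmul := (hP'.fun_mul (hQ'.fun_inv hQ)).hasFDerivAt.fun_mul hQ'.hasFDerivAt
  have heq : (fun z ↦ P z * (Q z)⁻¹ * Q z) =ᶠ[𝓝 (y, ξ)] P :=
    (hQ'.continuousAt.eventually_ne hQ).mono fun z hz ↦ by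
      simp only [mul_assoc, inv_mul_cancel₀ hz, mul_one]
  have h2 := (hmul.congr_of_eventuallyEq heq.symm).fderiv
  simp only [poissonBracket_eq_fderiv, div_eq_mul_inv] at h1 ⊢
  rw [h2]
  simp only [FunLike.coe_add, FunLike.coe_smul, Pi.add_apply, Pi.smul_apply, smul_eq_mul, h1]
  field_simp
  ring

/-- From $p'q=pq'$ and coprimality $q$ divides $q'$. The bracket with a quadratic Hamiltonian raises
the degree by one, so the quotient is linear in the momenta, and the same quotient serves for $p'$.
-/
theorem exists_isLogDeriv_of_coprime (hPQ : IsLocalIntegral Ω h r s P Q) (hΩ : IsOpen Ω)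
    (hh : IsFiberPoly Ω 2 h) {y : 𝔼 m} (hy : y ∈ Ω) (hc : IsCoprimeFiber r s P Q y) :
    ∃ l, IsLogDeriv h P Q y l := by
  obtain ⟨p, q, hp, hq, hq0, hpq, hP, hQ⟩ := hc
  obtain ⟨p', hp', hP'⟩ := hPQ.num.exists_poissonBracket hΩ hh hy
  obtain ⟨q', hq', hQ'⟩ := hPQ.den.exists_poissonBracket hΩ hh hy
  have hcross : p' * q = p * q' := by
    -- The cross identity is known only where $Q\ne0$; the extra factor $q$ makes it hold everywhere
    -- and is then cancelled.
    have : (p' * q - p * q') * q = 0 := by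
      refine eq_zero_of_evalAt_eq_zero isOpen_univ univ_nonempty fun ξ _ ↦ ?_
      rw [evalAt_mul, evalAt_sub, evalAt_mul, evalAt_mul, ← hP, ← hQ, ← hP', ← hQ']
      by_cases hQ0 : Q (y, ξ) = 0
      · rw [hQ0, mul_zero]
      · rw [hPQ.bracket_mul_eq hΩ hy hQ0, sub_self, zero_mul]
    exact sub_eq_zero.1 ((mul_eq_zero.1 this).resolve_right hq0)
  obtain ⟨l, hl⟩ : q ∣ q' :=
    hpq.symm.dvd_of_dvd_mul_left (hcross ▸ dvd_mul_left q p')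
  obtain ⟨l, hl1, hl⟩ := exists_isHomogeneous_cofactor hq hq' hl
  obtain ⟨v, hv⟩ := exists_inner_of_isHomogeneous_one hl1
  have hp'l : p' = p * l := by
    apply mul_right_cancel₀ hq0
    rw [hcross, hl]
    ring
  refine ⟨v, fun ξ ↦ ?_⟩
  rw [hP', hQ', hP, hQ, hp'l, hl, evalAt_mul, evalAt_mul, hv]
  exact ⟨mul_comm _ _, mul_comm _ _⟩

end IsLocalIntegral

/-- A factor that is linear in the momenta is locally bounded if multiplication of a function
without zero fibre by it gives a continuous function. -/
theorem exists_norm_le_of_mul_eq {f f' : 𝔼 m × 𝔼 m → ℝ} {y₀ ξ₀ : 𝔼 m}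
    (hf : ContinuousAt f (y₀, ξ₀)) (hf' : ContinuousAt f' (y₀, ξ₀)) (h0 : f (y₀, ξ₀) ≠ 0) :
    ∃ C : ℝ, ∀ᶠ y in 𝓝 y₀, ∀ l : 𝔼 m, (∀ ξ, f' (y, ξ) = inner ℝ l ξ * f (y, ξ)) → ‖l‖ ≤ C := by
  have hdiv : ContinuousAt (fun z ↦ f' z / f z) (y₀, ξ₀) := hf'.div hf h0
  set B := |f' (y₀, ξ₀) / f (y₀, ξ₀)| + 1
  have h1 : ∀ᶠ z in 𝓝 (y₀, ξ₀), |f' z / f z| < B ∧ f z ≠ 0 :=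
    (hdiv.abs.eventually (gt_mem_nhds (lt_add_one _))).and (hf.eventually_ne h0)
  rw [nhds_prod_eq, Filter.eventually_prod_iff] at h1
  obtain ⟨pa, ha, pb, hb, hab⟩ := h1
  obtain ⟨δ, hδ, hball⟩ := Metric.nhds_basis_closedBall.mem_iff.1 hb
  refine ⟨2 * B / δ, ha.mono fun y hy l hl ↦ ?_⟩
  have key : ∀ ξ ∈ closedBall ξ₀ δ, |inner ℝ l ξ| ≤ B := by
    intro ξ hξ
    obtain ⟨h2, h3⟩ := hab hy (hball hξ)
    rw [hl ξ, mul_div_cancel_right₀ _ h3] at h2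
    exact h2.le
  rcases eq_or_ne l 0 with rfl | hl0
  · rw [norm_zero]
    positivity
  have hln : 0 < ‖l‖ := norm_pos_iff.2 hl0
  have h2 := key ξ₀ (mem_closedBall_self hδ.le)
  -- Between $\xi_0$ and $\xi_0+\delta l/\|l\|$ the linear function grows by $\delta\|l\|$, while
  -- its absolute value is at most $B$ at both; hence $\|l\|\le 2B/\delta$.
  have h3 := key (ξ₀ + (δ / ‖l‖) • l) (by
    rw [mem_closedBall_iff_norm, add_sub_cancel_left, norm_smul, Real.norm_of_nonneg
      (by positivity), div_mul_cancel₀ _ hln.ne'])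
  rw [inner_add_right, inner_smul_right, real_inner_self_eq_norm_sq] at h3
  have h4 : δ / ‖l‖ * ‖l‖ ^ 2 = δ * ‖l‖ := by field_simp
  rw [h4] at h3
  rw [le_div_iff₀ hδ]
  have := abs_le.1 h2
  have := abs_le.1 h3
  linarith

namespace IsLocalIntegral

variable {Ω : Set (𝔼 m)} {h : 𝔼 m × 𝔼 m → ℝ} {r s : ℕ} {P Q : 𝔼 m × 𝔼 m → ℝ}

/-- One of $P,Q$ is nonzero at some momentum over $y_0$, and the quotient of its bracket by it is
continuous there; this bounds every admissible $l$ over nearby positions. -/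
theorem exists_bound_isLogDeriv (hPQ : IsLocalIntegral Ω h r s P Q) (hΩ : IsOpen Ω)
    (hh : ContDiffOn ℝ ∞ h (Ω ×ˢ univ)) {y₀ : 𝔼 m} (hy : y₀ ∈ Ω) :
    ∃ C : ℝ, ∀ᶠ y in 𝓝 y₀, ∀ l : 𝔼 m, IsLogDeriv h P Q y l → ‖l‖ ≤ C := by
  have hΩ' : ∀ ξ : 𝔼 m, Ω ×ˢ univ ∈ 𝓝 (y₀, ξ) := fun ξ ↦
    (hΩ.prod isOpen_univ).mem_nhds ⟨hy, mem_univ _⟩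
  obtain ⟨ξ, hξ | hξ⟩ := hPQ.not_both_zero y₀ hy
  · obtain ⟨C, hC⟩ := exists_norm_le_of_mul_eq (hPQ.num.continuousAt hΩ hy ξ)
      ((continuousOn_poissonBracket hΩ hh hPQ.num.contDiffOn).continuousAt (hΩ' ξ)) hξ
    exact ⟨C, hC.mono fun y hy l hl ↦ hy l fun ξ ↦ (hl ξ).1⟩
  · obtain ⟨C, hC⟩ := exists_norm_le_of_mul_eq (hPQ.den.continuousAt hΩ hy ξ)
      ((continuousOn_poissonBracket hΩ hh hPQ.den.contDiffOn).continuousAt (hΩ' ξ)) hξ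
    exact ⟨C, hC.mono fun y hy l hl ↦ hy l fun ξ ↦ (hl ξ).2⟩

/-- Over a position where $P$ and $Q$ have a common factor, division is not available. Coprime
positions are dense and their $l$ stay bounded nearby, so a cluster point exists, and both
identities survive the limit by continuity. -/
theorem exists_isLogDeriv (hPQ : IsLocalIntegral Ω h r s P Q) (hΩ : IsOpen Ω)
    (hh : IsFiberPoly Ω 2 h) {y : 𝔼 m} (hy : y ∈ Ω) : ∃ l, IsLogDeriv h P Q y l := by
  set A := {y | y ∈ Ω ∧ IsCoprimeFiber r s P Q y}
  have hA : ∀ y' : 𝔼 m, ∃ l, y' ∈ A → IsLogDeriv h P Q y' l := fun y' ↦ by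
    by_cases h : y' ∈ A
    · obtain ⟨l, hl⟩ := hPQ.exists_isLogDeriv_of_coprime hΩ hh h.1 h.2
      exact ⟨l, fun _ ↦ hl⟩
    · exact ⟨0, fun h' ↦ absurd h' h⟩
  choose L hL using hA
  obtain ⟨C, hC⟩ := hPQ.exists_bound_isLogDeriv hΩ hh.contDiffOn hy
  have hne : (𝓝[A] y).NeBot := mem_closure_iff_nhdsWithin_neBot.1 (hPQ.coprime hy)
  have hmem : ∀ᶠ y' in 𝓝[A] y, L y' ∈ closedBall (0 : 𝔼 m) C := by
    filter_upwards [self_mem_nhdsWithin, hC.filter_mono nhdsWithin_le_nhds] with y' h1 h2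
    rw [mem_closedBall_zero_iff]
    exact h2 _ (hL y' h1)
  obtain ⟨l, -, hl⟩ := (isCompact_closedBall (0 : 𝔼 m) C).exists_mapClusterPt
    (f := 𝓝[A] y) (u := L) (Filter.le_principal_iff.2 hmem)
  -- An ultrafilter turns the cluster point into an honest limit, the same for all momenta.
  obtain ⟨U, hU, hUl⟩ := mapClusterPt_iff_ultrafilter.1 hl
  refine ⟨l, fun ξ ↦ ?_⟩
  have hΩ' : Ω ×ˢ univ ∈ 𝓝 (y, ξ) := (hΩ.prod isOpen_univ).mem_nhds ⟨hy, mem_univ _⟩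
  have hy' : Filter.Tendsto (fun y' : 𝔼 m ↦ (y', ξ)) U (𝓝 (y, ξ)) :=
    ((Continuous.prodMk_left ξ).tendsto y).mono_left (hU.trans nhdsWithin_le_nhds)
  have hin : Filter.Tendsto (fun y' ↦ (inner ℝ (L y') ξ : ℝ)) U (𝓝 (inner ℝ l ξ)) :=
    hUl.inner tendsto_const_nhds
  have hAU : ∀ᶠ y' in (U : Filter (𝔼 m)), y' ∈ A := hU self_mem_nhdsWithin
  have hlim : ∀ f : 𝔼 m × 𝔼 m → ℝ, ContDiffOn ℝ ∞ f (Ω ×ˢ univ) →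
      (∀ y' ∈ A, poissonBracket h f (y', ξ) = inner ℝ (L y') ξ * f (y', ξ)) →
      poissonBracket h f (y, ξ) = inner ℝ l ξ * f (y, ξ) := by
    intro f hf hLf
    refine tendsto_nhds_unique
      (((continuousOn_poissonBracket hΩ hh.contDiffOn hf).continuousAt hΩ').tendsto.comp hy') ?_
    refine (hin.mul ((hf.continuousOn.continuousAt hΩ').tendsto.comp hy')).congr' ?_
    exact hAU.mono fun y' h ↦ (hLf y' h).symm
  exact ⟨hlim P hPQ.num.contDiffOn fun y' h ↦ (hL y' h ξ).1,
    hlim Q hPQ.den.contDiffOn fun y' h ↦ (hL y' h ξ).2⟩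

/-- Boundedness on compact sets replaces any continuous dependence of $l$ on the position, which the
transport argument does not need. -/
theorem exists_isLogDeriv_norm_le (hPQ : IsLocalIntegral Ω h r s P Q) (hΩ : IsOpen Ω)
    (hh : IsFiberPoly Ω 2 h) {K : Set (𝔼 m)} (hK : IsCompact K) (hKΩ : K ⊆ Ω) :
    ∃ C : ℝ, ∀ y ∈ K, ∃ l, IsLogDeriv h P Q y l ∧ ‖l‖ ≤ C := by
  suffices ∃ C : ℝ, ∀ y ∈ K, ∀ l, IsLogDeriv h P Q y l → ‖l‖ ≤ C by
    obtain ⟨C, hC⟩ := this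
    refine ⟨C, fun y hy ↦ ?_⟩
    obtain ⟨l, hl⟩ := hPQ.exists_isLogDeriv hΩ hh (hKΩ hy)
    exact ⟨l, hl, hC y hy l hl⟩
  refine hK.induction_on (p := fun K ↦ ∃ C : ℝ, ∀ y ∈ K, ∀ l, IsLogDeriv h P Q y l → ‖l‖ ≤ C)
    ⟨0, by simp⟩ ?_ ?_ ?_
  · rintro s t hst ⟨C, hC⟩
    exact ⟨C, fun y hy ↦ hC y (hst hy)⟩
  · rintro s t ⟨C, hC⟩ ⟨C', hC'⟩
    refine ⟨max C C', fun y hy l hl ↦ ?_⟩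
    rcases hy with hy | hy
    · exact (hC y hy l hl).trans (le_max_left _ _)
    · exact (hC' y hy l hl).trans (le_max_right _ _)
  · intro y hy
    obtain ⟨C, hC⟩ := hPQ.exists_bound_isLogDeriv hΩ hh.contDiffOn (hKΩ hy)
    exact ⟨_, mem_nhdsWithin_of_mem_nhds hC, C, fun y hy ↦ hy⟩

/-- If two rational first integrals agree at the end of an integral curve, they agree at its
beginning. -/
theorem cross_eq_of_integralCurve {P' Q' : 𝔼 m × 𝔼 m → ℝ} (hPQ : IsLocalIntegral Ω h r s P Q)
    (hPQ' : IsLocalIntegral Ω h r s P' Q') (hΩ : IsOpen Ω) (hh : IsFiberPoly Ω 2 h)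
    {K : Set (𝔼 m × 𝔼 m)} (hK : IsCompact K) (hKΩ : K ⊆ Ω ×ˢ univ) {T : ℝ} (hT : 0 ≤ T)
    {z : ℝ → 𝔼 m × 𝔼 m}
    (hz : ∀ t ∈ Icc 0 T, z t ∈ K ∧ HasDerivWithinAt z (hamVec h (z t)) (Icc 0 T) t)
    (hend : P (z T) * Q' (z T) = P' (z T) * Q (z T)) :
    P (z 0) * Q' (z 0) = P' (z 0) * Q (z 0) := by
  have hK₁ : IsCompact (Prod.fst '' K) := hK.image continuous_fst
  have hK₁Ω : Prod.fst '' K ⊆ Ω := by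
    rintro _ ⟨w, hw, rfl⟩
    exact (hKΩ hw).1
  obtain ⟨C, hC⟩ := hPQ.exists_isLogDeriv_norm_le hΩ hh hK₁ hK₁Ω
  obtain ⟨C', hC'⟩ := hPQ'.exists_isLogDeriv_norm_le hΩ hh hK₁ hK₁Ω
  obtain ⟨R, hR⟩ := hK.isBounded.exists_norm_le
  set D : 𝔼 m × 𝔼 m → ℝ := fun w ↦ P w * Q' w - P' w * Q w with hD
  -- Along the flow $P,Q$ have logarithmic derivative $l$ and $P',Q'$ have $l'$, so both products in
  -- $D$, and $D$ itself, have $l+l'$.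
  have hfac : ∀ w : 𝔼 m × 𝔼 m, ∃ a : ℝ, w ∈ K → |a| ≤ |C + C'| * |R| ∧
      HasFDerivAt D (fderiv ℝ D w) w ∧ fderiv ℝ D w (hamVec h w) = a * D w := by
    rintro ⟨y, ξ⟩
    by_cases hw : (y, ξ) ∈ K
    swap
    · exact ⟨0, fun h ↦ absurd h hw⟩
    obtain ⟨l, hl, hlC⟩ := hC y ⟨_, hw, rfl⟩
    obtain ⟨l', hl', hlC'⟩ := hC' y ⟨_, hw, rfl⟩
    have hy := (hKΩ hw).1
    have hd := ((hPQ.num.differentiableAt hΩ hy ξ).hasFDerivAt.fun_mul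
      (hPQ'.den.differentiableAt hΩ hy ξ).hasFDerivAt).fun_sub
      ((hPQ'.num.differentiableAt hΩ hy ξ).hasFDerivAt.fun_mul
      (hPQ.den.differentiableAt hΩ hy ξ).hasFDerivAt)
    refine ⟨inner ℝ (l + l') ξ, fun _ ↦ ⟨?_, hd.differentiableAt.hasFDerivAt, ?_⟩⟩
    · refine (abs_real_inner_le_norm _ _).trans ?_
      gcongr
      · exact (norm_add_le _ _).trans ((add_le_add hlC hlC').trans (le_abs_self _))
      · exact (norm_snd_le (y, ξ)).trans ((hR _ hw).trans (le_abs_self _))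
    · rw [hd.fderiv]
      have h1 := hl ξ
      have h2 := hl' ξ
      simp only [poissonBracket_eq_fderiv] at h1 h2
      simp only [hD, FunLike.coe_add, FunLike.coe_sub, FunLike.coe_smul,
        Pi.add_apply, Pi.sub_apply, Pi.smul_apply, smul_eq_mul, h1.1, h1.2, h2.1, h2.2,
        inner_add_left]
      ring
  choose a ha using hfac
  have hderiv : ∀ t ∈ Icc 0 T, HasDerivWithinAt (fun t ↦ D (z t)) (a (z t) * D (z t))
      (Icc 0 T) t := by
    intro t ht
    obtain ⟨h1, h2⟩ := hz t ht
    obtain ⟨-, h3, h4⟩ := ha _ h1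
    rw [← h4]
    exact h3.comp_hasDerivWithinAt t h2
  have hside : ∀ {f : ℝ → ℝ} {c : ℝ} {t : ℝ}, t ∈ Ioc 0 T →
      HasDerivWithinAt f c (Icc 0 T) t → HasDerivWithinAt f c (Iic t) t := by
    intro f c t ht hf
    exact (hf.mono (Icc_subset_Icc_right ht.2)).mono_of_mem_nhdsWithin (Icc_mem_nhdsLE ht.1)
  -- Uniqueness, run backwards from the end time, compares $D$ with the zero solution. It needs the
  -- coefficient `a (z t)` bounded, not continuous in $t$.
  have hEq := ODE_solution_unique_of_mem_Icc_left
    (v := fun t x ↦ a (z t) * x) (s := fun _ ↦ univ) (K := ⟨|C + C'| * |R|, by positivity⟩)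
    (f := fun t ↦ D (z t)) (g := fun _ ↦ 0) (a := 0) (b := T)
    (fun t ht ↦ (LipschitzWith.of_dist_le_mul fun x y ↦ by
      rw [Real.dist_eq, Real.dist_eq, ← mul_sub, abs_mul]
      exact mul_le_mul_of_nonneg_right (ha _ (hz t (Ioc_subset_Icc_self ht)).1).1
        (abs_nonneg _)).lipschitzOnWith)
    (fun t ht ↦ (hderiv t ht).continuousWithinAt)
    (fun t ht ↦ hside ht (hderiv t (Ioc_subset_Icc_self ht))) (fun _ _ ↦ mem_univ _)
    continuousOn_const (fun t _ ↦ by simpa using hasDerivWithinAt_const t _ (0 : ℝ))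
    (fun _ _ ↦ mem_univ _) (sub_eq_zero.2 hend)
  exact sub_eq_zero.1 (hEq ⟨le_rfl, hT⟩)

end IsLocalIntegral

end LocalIntegrals

/-! ### Linear conditions that cut out a line -/

section LinearAlgebra

variable {V : Type*} [NormedAddCommGroup V] [InnerProductSpace ℝ V] [FiniteDimensional ℝ V]

/-- The orthogonal complement of $S$ is a line, so the span of $S$ has dimension $n$ and a basis can
be taken from $S$ itself. -/
theorem exists_linearIndependent_of_orthogonal_eq_span {n : ℕ} (hV : Module.finrank ℝ V = n + 1)
    {S : Set V} {w : V} (hw : w ≠ 0)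
    (hS : ∀ v, (∀ x ∈ S, inner ℝ x v = 0) ↔ ∃ c : ℝ, v = c • w) :
    ∃ f : Fin n → V, (∀ k, f k ∈ S) ∧ LinearIndependent ℝ f := by
  have horth : (Submodule.span ℝ S)ᗮ = Submodule.span ℝ {w} := by
    ext v
    rw [Submodule.mem_span_singleton]
    refine Iff.trans ?_ ((hS v).trans ⟨fun ⟨c, h⟩ ↦ ⟨c, h.symm⟩, fun ⟨c, h⟩ ↦ ⟨c, h.symm⟩⟩)
    rw [Submodule.mem_orthogonal]
    refine ⟨fun h x hx ↦ h x (Submodule.subset_span hx), fun h u hu ↦ ?_⟩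
    induction hu using Submodule.span_induction with
    | mem x hx => exact h x hx
    | zero => exact inner_zero_left _
    | add _ _ _ _ h1 h2 => rw [inner_add_left, h1, h2, add_zero]
    | smul c _ _ h1 => rw [inner_smul_left, h1, mul_zero]
  have hrank : Module.finrank ℝ (Submodule.span ℝ S) = n := by
    have := (Submodule.span ℝ S).finrank_add_finrank_orthogonal
    rw [horth, finrank_span_singleton hw, hV] at this
    omega
  obtain ⟨f, hf, -, hli⟩ := Submodule.exists_fun_fin_finrank_span_eq ℝ S
  exact ⟨f ∘ finCongr hrank.symm, fun k ↦ hf _, hli.comp _ (finCongr hrank.symm).injective⟩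

/-- In dimension $n+1$, the complement of $n$ independent vectors is a line, spanned by any nonzero
element. -/
theorem exists_eq_smul_of_orthogonal {n : ℕ} (hV : Module.finrank ℝ V = n + 1) {f : Fin n → V}
    (hf : LinearIndependent ℝ f) {v w : V} (hw : w ≠ 0) (hfw : ∀ k, inner ℝ (f k) w = 0)
    (hfv : ∀ k, inner ℝ (f k) v = 0) : ∃ c : ℝ, v = c • w := by
  have hmem : ∀ u : V, (∀ k, inner ℝ (f k) u = 0) → u ∈ (Submodule.span ℝ (range f))ᗮ := by
    intro u hu
    rw [Submodule.mem_orthogonal]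
    intro x hx
    induction hx using Submodule.span_induction with
    | mem x hx => obtain ⟨k, rfl⟩ := hx; exact hu k
    | zero => exact inner_zero_left _
    | add _ _ _ _ h1 h2 => rw [inner_add_left, h1, h2, add_zero]
    | smul c _ _ h1 => rw [inner_smul_left, h1, mul_zero]
  have hrank : Module.finrank ℝ (Submodule.span ℝ (range f))ᗮ = 1 := by
    have := (Submodule.span ℝ (range f)).finrank_add_finrank_orthogonal
    rw [finrank_span_eq_card hf, Fintype.card_fin, hV] at this
    omega
  obtain ⟨c, hc⟩ := (finrank_eq_one_iff_of_nonzero' (⟨w, hmem w hfw⟩ :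
    (Submodule.span ℝ (range f))ᗮ) (by simpa [Subtype.ext_iff] using hw)).1 hrank ⟨v, hmem v hfv⟩
  exact ⟨c, (congrArg Subtype.val hc).symm⟩

end LinearAlgebra

/-! ### Test families: momenta at which the values of a fraction determine it -/

section TestFamilies

variable {m : ℕ}

/-- The exponents of the monomials of degree `d` in `m` variables. -/
abbrev Exponents (m d : ℕ) : Type :=
  {α : Fin m →₀ ℕ // α ∈ (Finset.univ : Finset (Fin m)).finsuppAntidiag d}

theorem card_exponents (m d : ℕ) : Fintype.card (Exponents m d) = (d + m - 1).choose d := by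
  rw [Fintype.card_coe, Finset.card_finsuppAntidiag_nat_eq_choose, Finset.card_univ,
    Fintype.card_fin, add_comm]

theorem Exponents.degree_eq {d : ℕ} (α : Exponents m d) : α.1.degree = d := by
  have := (Finset.mem_finsuppAntidiag.1 α.2).1
  rw [Finsupp.degree_eq_sum]
  exact this

theorem evalAt_eq_sum {d : ℕ} {p : MvPolynomial (Fin m) ℝ} (hp : p.IsHomogeneous d) (ξ : 𝔼 m) :
    evalAt p ξ = ∑ α : Exponents m d, evalAt (MvPolynomial.monomial α.1 1) ξ * p.coeff α.1 := by
  have h1 : evalAt p ξ = ∑ α ∈ (Finset.univ : Finset (Fin m)).finsuppAntidiag d,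
      evalAt (MvPolynomial.monomial α 1) ξ * p.coeff α := by
    have h2 : evalAt p ξ = ∑ α ∈ p.support,
        evalAt (MvPolynomial.monomial α 1) ξ * p.coeff α := by
      rw [evalAt, MvPolynomial.eval_eq']
      refine Finset.sum_congr rfl fun α _ ↦ ?_
      rw [evalAt, MvPolynomial.eval_monomial, one_mul, mul_comm, Finsupp.prod_fintype]
      simp
    rw [h2]
    refine Finset.sum_subset (fun α hα ↦ ?_) fun α _ hα ↦ ?_
    · rw [Finset.mem_finsuppAntidiag]
      refine ⟨?_, Finset.subset_univ _⟩
      rw [← Finsupp.degree_eq_sum]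
      by_contra h
      exact MvPolynomial.mem_support_iff.1 hα (hp.coeff_eq_zero h)
    · rw [MvPolynomial.notMem_support_iff.1 hα, mul_zero]
  rw [h1, ← Finset.sum_coe_sort]

/-- The space of coefficients of pairs of homogeneous polynomials of degrees `r` and `s`. -/
abbrev CoeffSpace (m r s : ℕ) : Type := EuclideanSpace ℝ (Exponents m r ⊕ Exponents m s)

/-- The vector of coefficients of a pair of polynomials. -/
def coeffVec (r s : ℕ) (p q : MvPolynomial (Fin m) ℝ) : CoeffSpace m r s :=
  WithLp.toLp 2 (Sum.elim (fun α ↦ p.coeff α.1) fun β ↦ q.coeff β.1)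

/-- The linear condition `c * p(ξ) = a * q(ξ)` on the coefficients of `(p, q)`. -/
def testVec (r s : ℕ) (a c : ℝ) (ξ : 𝔼 m) : CoeffSpace m r s :=
  WithLp.toLp 2 (Sum.elim (fun α ↦ c * evalAt (MvPolynomial.monomial α.1 1) ξ)
    fun β ↦ -(a * evalAt (MvPolynomial.monomial β.1 1) ξ))

theorem inner_testVec_coeffVec {r s : ℕ} {p q : MvPolynomial (Fin m) ℝ} (hp : p.IsHomogeneous r)
    (hq : q.IsHomogeneous s) (a c : ℝ) (ξ : 𝔼 m) :
    inner ℝ (testVec r s a c ξ) (coeffVec r s p q) = c * evalAt p ξ - a * evalAt q ξ := by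
  rw [evalAt_eq_sum hp, evalAt_eq_sum hq, PiLp.inner_apply, Fintype.sum_sum_type]
  simp only [testVec, coeffVec, Sum.elim_inl, Sum.elim_inr, Real.inner_apply, neg_mul,
    Finset.sum_neg_distrib, Finset.mul_sum, mul_assoc, sub_eq_add_neg]

theorem continuous_testVec (m r s : ℕ) :
    Continuous fun x : ℝ × ℝ × 𝔼 m ↦ testVec r s x.1 x.2.1 x.2.2 := by
  apply (PiLp.continuous_toLp 2 _).comp
  refine continuous_pi fun i ↦ ?_
  rcases i with α | β
  · exact continuous_snd.fst.mul ((continuous_evalAt _).comp continuous_snd.snd)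
  · exact (continuous_fst.mul ((continuous_evalAt _).comp continuous_snd.snd)).neg

theorem eq_of_coeff_eq {d : ℕ} {p q : MvPolynomial (Fin m) ℝ} (hp : p.IsHomogeneous d)
    (hq : q.IsHomogeneous d) (h : ∀ α : Exponents m d, p.coeff α.1 = q.coeff α.1) : p = q := by
  refine evalAt_injective (funext fun ξ ↦ ?_)
  rw [evalAt_eq_sum hp, evalAt_eq_sum hq]
  simp only [h]

theorem coeffVec_eq_smul_iff {r s : ℕ} {p q p' q' : MvPolynomial (Fin m) ℝ}
    (hp : p.IsHomogeneous r) (hq : q.IsHomogeneous s) (hp' : p'.IsHomogeneous r)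
    (hq' : q'.IsHomogeneous s) (c : ℝ) :
    coeffVec r s p' q' = c • coeffVec r s p q ↔
      p' = MvPolynomial.C c * p ∧ q' = MvPolynomial.C c * q := by
  constructor
  · intro h
    have h' := fun i ↦ congrArg (fun v : CoeffSpace m r s ↦ v i) h
    refine ⟨eq_of_coeff_eq hp' (hp.C_mul c) fun α ↦ ?_, eq_of_coeff_eq hq' (hq.C_mul c) fun β ↦ ?_⟩
    · simpa [coeffVec, MvPolynomial.coeff_C_mul] using h' (Sum.inl α)
    · simpa [coeffVec, MvPolynomial.coeff_C_mul] using h' (Sum.inr β)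
  · rintro ⟨rfl, rfl⟩
    ext i
    rcases i with α | β <;> simp [coeffVec, MvPolynomial.coeff_C_mul]

theorem coeffVec_ne_zero {r s : ℕ} {p q : MvPolynomial (Fin m) ℝ} (hp : p.IsHomogeneous r)
    (hq : q.IsHomogeneous s) (h : p ≠ 0 ∨ q ≠ 0) : coeffVec r s p q ≠ 0 := by
  intro h0
  have := (coeffVec_eq_smul_iff hp hq hp hq 0).1 (by rw [h0, zero_smul])
  rw [map_zero, zero_mul, zero_mul] at this
  exact h.elim (fun h ↦ h this.1) fun h ↦ h this.2

theorem exists_coeffVec_eq {r s : ℕ} (v : CoeffSpace m r s) :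
    ∃ p q : MvPolynomial (Fin m) ℝ, p.IsHomogeneous r ∧ q.IsHomogeneous s ∧
      coeffVec r s p q = v := by
  refine ⟨∑ α : Exponents m r, MvPolynomial.monomial α.1 (v (Sum.inl α)),
    ∑ β : Exponents m s, MvPolynomial.monomial β.1 (v (Sum.inr β)),
    MvPolynomial.IsHomogeneous.sum _ _ _ fun α _ ↦ MvPolynomial.isHomogeneous_monomial _ α.degree_eq,
    MvPolynomial.IsHomogeneous.sum _ _ _ fun α _ ↦ MvPolynomial.isHomogeneous_monomial _ α.degree_eq,
    ?_⟩
  ext i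
  rcases i with α | β
  · simp [coeffVec, MvPolynomial.coeff_sum, MvPolynomial.coeff_monomial]
  · simp [coeffVec, MvPolynomial.coeff_sum, MvPolynomial.coeff_monomial]

/-- The number of parameters of a fraction of homogeneous polynomials of degrees `r` and `s`. -/
def fracDim (m r s : ℕ) : ℕ := (r + m - 1).choose r + (s + m - 1).choose s - 1

theorem finrank_coeffSpace (hm : 1 ≤ m) (r s : ℕ) :
    Module.finrank ℝ (CoeffSpace m r s) = fracDim m r s + 1 := by
  have : 0 < (r + m - 1).choose r := Nat.choose_pos (by omega)
  rw [finrank_euclideanSpace, Fintype.card_sum, card_exponents, card_exponents, fracDim]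
  omega

/-- The values of `P / Q` at the momenta `x k` over the position `y` are independent conditions on
the coefficients of a fraction. -/
def IsTestFamily (r s : ℕ) {n : ℕ} (P Q : 𝔼 m × 𝔼 m → ℝ) (y : 𝔼 m) (x : Fin n → 𝔼 m) : Prop :=
  LinearIndependent ℝ fun k ↦ testVec r s (P (y, x k)) (Q (y, x k)) (x k)

/-- Over the position `y`, `P` and `Q` are homogeneous polynomials in the momenta, not both
zero. -/
def IsFiberFraction (r s : ℕ) (P Q : 𝔼 m × 𝔼 m → ℝ) (y : 𝔼 m) : Prop :=
  ∃ p q : MvPolynomial (Fin m) ℝ, p.IsHomogeneous r ∧ q.IsHomogeneous s ∧ (p ≠ 0 ∨ q ≠ 0) ∧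
    (∀ ξ, P (y, ξ) = evalAt p ξ) ∧ ∀ ξ, Q (y, ξ) = evalAt q ξ

/-- A fraction is determined up to a constant factor by its values on a test family. -/
theorem IsTestFamily.exists_eq_mul (hm : 1 ≤ m) {r s : ℕ} {P Q P' Q' : 𝔼 m × 𝔼 m → ℝ} {y : 𝔼 m}
    {x : Fin (fracDim m r s) → 𝔼 m} (hx : IsTestFamily r s P Q y x)
    (hPQ : IsFiberFraction r s P Q y) (hPQ' : IsFiberFraction r s P' Q' y)
    (h : ∀ k, P (y, x k) * Q' (y, x k) = P' (y, x k) * Q (y, x k)) :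
    ∃ c : ℝ, c ≠ 0 ∧ ∀ ξ, P' (y, ξ) = c * P (y, ξ) ∧ Q' (y, ξ) = c * Q (y, ξ) := by
  obtain ⟨p, q, hp, hq, hpq, hP, hQ⟩ := hPQ
  obtain ⟨p', q', hp', hq', hpq', hP', hQ'⟩ := hPQ'
  obtain ⟨c, hc⟩ := exists_eq_smul_of_orthogonal (finrank_coeffSpace hm r s) hx
    (coeffVec_ne_zero hp hq hpq) (v := coeffVec r s p' q')
    (fun k ↦ by rw [inner_testVec_coeffVec hp hq, hP, hQ]; ring)
    (fun k ↦ by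
      rw [inner_testVec_coeffVec hp' hq', ← hP', ← hQ', h k]
      ring)
  obtain ⟨hc₁, hc₂⟩ := (coeffVec_eq_smul_iff hp hq hp' hq' c).1 hc
  refine ⟨c, ?_, fun ξ ↦ ?_⟩
  · rintro rfl
    rw [map_zero, zero_mul] at hc₁ hc₂
    exact hpq'.elim (fun h ↦ h hc₁) fun h ↦ h hc₂
  · rw [hP, hQ, hP', hQ', hc₁, hc₂]
    simp [evalAt]

theorem IsTestFamily.of_eq_mul {r s n : ℕ} {P Q P' Q' : 𝔼 m × 𝔼 m → ℝ} {y : 𝔼 m}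
    {x : Fin n → 𝔼 m} (hx : IsTestFamily r s P Q y x) {c : ℝ} (hc : c ≠ 0)
    (h : ∀ ξ, P' (y, ξ) = c * P (y, ξ) ∧ Q' (y, ξ) = c * Q (y, ξ)) :
    IsTestFamily r s P' Q' y x := by
  have := hx.units_smul fun _ ↦ Units.mk0 c hc
  rw [IsTestFamily]
  convert! this using 1
  ext k i
  rcases i with α | β <;> simp [testVec, h, Units.smul_def, mul_assoc]

/-- Test families exist over every position at which the fraction is in lowest terms. -/
theorem IsCoprimeFiber.exists_isTestFamily (hm : 1 ≤ m) {r s : ℕ} {P Q : 𝔼 m × 𝔼 m → ℝ} {y : 𝔼 m}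
    (hy : IsCoprimeFiber r s P Q y) {S B : Set (𝔼 m)} (hB : IsOpen B) (hBne : B.Nonempty)
    (hBS : B ⊆ closure S) :
    ∃ x : Fin (fracDim m r s) → 𝔼 m, (∀ k, x k ∈ S) ∧ IsTestFamily r s P Q y x := by
  obtain ⟨p, q, hp, hq, hq0, hpq, hP, hQ⟩ := hy
  obtain ⟨f, hf, hli⟩ := exists_linearIndependent_of_orthogonal_eq_span
    (finrank_coeffSpace hm r s) (coeffVec_ne_zero hp hq (Or.inr hq0))
    (S := (fun ξ ↦ testVec r s (P (y, ξ)) (Q (y, ξ)) ξ) '' S) (fun v ↦ by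
      constructor
      · intro hv
        obtain ⟨a, b, ha, hb, rfl⟩ := exists_coeffVec_eq v
        -- A vector orthogonal to the test vectors of $S$ is a pair $(a,b)$ with $qa=pb$ on $S$. The
        -- closure of $S$ contains an open set, so this is an identity of polynomials.
        have h0 : q * a - p * b = 0 := by
          refine eq_zero_of_evalAt_eq_zero hB hBne fun ξ hξ ↦ ?_
          have hcl : IsClosed {ξ : 𝔼 m | evalAt (q * a - p * b) ξ = 0} :=
            isClosed_eq (continuous_evalAt _) continuous_const
          refine hcl.closure_subset_iff.2 (fun ζ hζ ↦ ?_) (hBS hξ)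
          have := hv _ ⟨ζ, hζ, rfl⟩
          rw [inner_testVec_coeffVec ha hb] at this
          rw [mem_ofPred_eq, evalAt_sub, evalAt_mul, evalAt_mul, ← hP, ← hQ, this]
        have h1 : q * a = p * b := sub_eq_zero.1 h0
        obtain ⟨l, hl⟩ : q ∣ b := hpq.symm.dvd_of_dvd_mul_left (h1 ▸ dvd_mul_right q a)
        -- Here $q$ and $b$ have the same degree, so the cofactor is a constant and $(a,b)$ is a
        -- multiple of $(p,q)$.
        obtain ⟨l, hl0, hl⟩ := exists_isHomogeneous_cofactor (d := 0) hq hb hl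
        rw [MvPolynomial.totalDegree_eq_zero_iff_eq_C.1
          ((MvPolynomial.totalDegree_zero_iff_isHomogeneous _).2 hl0)] at hl
        refine ⟨_, (coeffVec_eq_smul_iff hp hq ha hb _).2
          ⟨mul_left_cancel₀ hq0 ?_, hl.trans (mul_comm _ _)⟩⟩
        rw [h1, hl]
        ring
      · rintro ⟨c, rfl⟩ _ ⟨ξ, -, rfl⟩
        rw [inner_smul_right, inner_testVec_coeffVec hp hq, hP, hQ]
        ring)
  choose x hxS hx using hf
  refine ⟨x, hxS, ?_⟩
  rw [IsTestFamily]
  convert! hli using 1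
  exact funext hx

/-- Linear independence is an open condition. It is used for moving positions with a fixed integral,
and for moving integrals over a fixed position. -/
theorem IsTestFamily.eventually {ι : Type*} {l : Filter ι} {r s n : ℕ}
    {a c : Fin n → ℝ} {x : Fin n → 𝔼 m}
    (h : LinearIndependent ℝ fun k ↦ testVec r s (a k) (c k) (x k))
    {a' c' : ι → Fin n → ℝ} {x' : ι → Fin n → 𝔼 m}
    (ha : ∀ k, Filter.Tendsto (fun i ↦ a' i k) l (𝓝 (a k)))
    (hc : ∀ k, Filter.Tendsto (fun i ↦ c' i k) l (𝓝 (c k)))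
    (hx : ∀ k, Filter.Tendsto (fun i ↦ x' i k) l (𝓝 (x k))) :
    ∀ᶠ i in l, LinearIndependent ℝ fun k ↦ testVec r s (a' i k) (c' i k) (x' i k) := by
  have hlim : Filter.Tendsto (fun i k ↦ testVec r s (a' i k) (c' i k) (x' i k)) l
      (𝓝 fun k ↦ testVec r s (a k) (c k) (x k)) :=
    tendsto_pi_nhds.2 fun k ↦ ((continuous_testVec m r s).tendsto _).comp
      ((ha k).prodMk_nhds ((hc k).prodMk_nhds (hx k)))
  exact hlim.eventually (isOpen_setOfPred_linearIndependent.mem_nhds h)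

end TestFamilies

/-! ### Shooting and local determination by $n^2$ values -/

section LocalRigidity

variable {m : ℕ}

/-- A Hamiltonian that is a smooth field over `Ω` of nondegenerate quadratic forms in the
momenta. -/
structure IsKinetic (Ω : Set (𝔼 m)) (h : 𝔼 m × 𝔼 m → ℝ) : Prop where
  isFiberPoly : IsFiberPoly Ω 2 h
  exists_velocity : ∃ G : 𝔼 m → 𝔼 m →L[ℝ] 𝔼 m, ContinuousOn G Ω ∧
    ∀ y ∈ Ω, (G y).IsInvertible ∧ ∀ ξ, (hamVec h (y, ξ)).1 = G y ξ

/-- `P / Q` and `P' / Q'` agree over the position `y`. -/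
def AgreeAt (P Q P' Q' : 𝔼 m × 𝔼 m → ℝ) (y : 𝔼 m) : Prop :=
  ∀ ξ, P (y, ξ) * Q' (y, ξ) = P' (y, ξ) * Q (y, ξ)

/-- The velocity is linear and the force quadratic in the momenta, so both vanish at zero momentum.
-/
theorem IsKinetic.hamVec_zero {Ω : Set (𝔼 m)} (hΩ : IsOpen Ω) {h : 𝔼 m × 𝔼 m → ℝ}
    (hh : IsKinetic Ω h) {y : 𝔼 m} (hy : y ∈ Ω) : hamVec h (y, 0) = 0 := by
  obtain ⟨G, -, hG⟩ := hh.exists_velocity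
  ext1
  · rw [(hG y hy).2, map_zero]
    rfl
  · have : ∀ v : 𝔼 m, fderiv ℝ h (y, 0) (v, 0) = 0 := by
      intro v
      obtain ⟨p, hp, hph⟩ := hh.isFiberPoly.exists_fderiv_position hΩ hy v
      rw [hph]
      have h0 : MvPolynomial.coeff 0 p = 0 := hp.coeff_eq_zero (by simp)
      have : (fun i ↦ (0 : 𝔼 m) i) = (0 : Fin m → ℝ) := rfl
      rw [evalAt, this, ← MvPolynomial.constantCoeff_eq] at *
      rwa [MvPolynomial.eval_zero]
    simp [hamVec, this]

theorem IsFiberPoly.agreeAt_of_isOpen {Ω : Set (𝔼 m)} {r s : ℕ} {P Q P' Q' : 𝔼 m × 𝔼 m → ℝ}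
    (hP : IsFiberPoly Ω r P) (hQ : IsFiberPoly Ω s Q) (hP' : IsFiberPoly Ω r P')
    (hQ' : IsFiberPoly Ω s Q') {y : 𝔼 m} (hy : y ∈ Ω) {S : Set (𝔼 m)} (hS : IsOpen S)
    (hne : S.Nonempty) (h : ∀ ξ ∈ S, P (y, ξ) * Q' (y, ξ) = P' (y, ξ) * Q (y, ξ)) :
    AgreeAt P Q P' Q' y := by
  obtain ⟨p, -, hp⟩ := hP.exists_poly y hy
  obtain ⟨q, -, hq⟩ := hQ.exists_poly y hy
  obtain ⟨p', -, hp'⟩ := hP'.exists_poly y hy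
  obtain ⟨q', -, hq'⟩ := hQ'.exists_poly y hy
  have h0 : p * q' - p' * q = 0 := eq_zero_of_evalAt_eq_zero hS hne fun ξ hξ ↦ by
    rw [evalAt_sub, evalAt_mul, evalAt_mul, ← hp, ← hq, ← hp', ← hq', h ξ hξ, sub_self]
  intro ξ
  have := congrArg (fun p ↦ evalAt p ξ) h0
  simp only [evalAt_sub, evalAt_mul, ← hp, ← hq, ← hp', ← hq'] at this
  rw [show evalAt 0 ξ = 0 by simp [evalAt]] at this
  exact sub_eq_zero.1 this

theorem IsLocalIntegral.isFiberFraction {Ω : Set (𝔼 m)} {h : 𝔼 m × 𝔼 m → ℝ} {r s : ℕ}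
    {P Q : 𝔼 m × 𝔼 m → ℝ} (hPQ : IsLocalIntegral Ω h r s P Q) {y : 𝔼 m} (hy : y ∈ Ω) :
    IsFiberFraction r s P Q y := by
  obtain ⟨p, hp, hpP⟩ := hPQ.num.exists_poly y hy
  obtain ⟨q, hq, hqQ⟩ := hPQ.den.exists_poly y hy
  refine ⟨p, q, hp, hq, ?_, hpP, hqQ⟩
  obtain ⟨ξ, hξ⟩ := hPQ.not_both_zero y hy
  rw [hpP, hqQ] at hξ
  refine hξ.imp ?_ ?_ <;> rintro h rfl <;> exact h (by simp [evalAt])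

/-- Shooting along integral curves of a kinetic Hamiltonian: a neighbourhood `W` of a position, and
an end point map `Φ` for initial positions in `W` and small initial momenta, such that agreement of
first integrals propagates from the end to the beginning of the integral curves. -/
structure ShootingData (Ω : Set (𝔼 m)) (h : 𝔼 m × 𝔼 m → ℝ) where
  W : Set (𝔼 m)
  rad : ℝ
  C : ℝ
  Φ : 𝔼 m × 𝔼 m → 𝔼 m × 𝔼 m
  isOpen : IsOpen W
  subset : W ⊆ Ω
  rad_pos : 0 < rad
  surj : ∀ y ∈ W, ∀ z ∈ W, ∃ ξ ∈ ball (0 : 𝔼 m) rad, (Φ (y, ξ)).1 = z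
  antilipschitz : ∀ y ∈ W, ∀ ξ ∈ ball (0 : 𝔼 m) rad, ∀ ξ' ∈ ball (0 : 𝔼 m) rad,
    ‖ξ - ξ'‖ ≤ C * ‖(Φ (y, ξ)).1 - (Φ (y, ξ')).1‖
  map_zero : ∀ y ∈ W, (Φ (y, 0)).1 = y
  continuousOn : ContinuousOn Φ (W ×ˢ ball (0 : 𝔼 m) rad)
  transport : ∀ {r s : ℕ} {P Q P' Q' : 𝔼 m × 𝔼 m → ℝ}, IsLocalIntegral Ω h r s P Q →
    IsLocalIntegral Ω h r s P' Q' → ∀ y ∈ W, ∀ ξ ∈ ball (0 : 𝔼 m) rad,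
    AgreeAt P Q P' Q' (Φ (y, ξ)).1 → P (y, ξ) * Q' (y, ξ) = P' (y, ξ) * Q (y, ξ)

theorem IsKinetic.exists_shootingData (hm : 1 ≤ m) {Ω : Set (𝔼 m)} (hΩ : IsOpen Ω)
    {h : 𝔼 m × 𝔼 m → ℝ} (hh : IsKinetic Ω h) {y₀ : 𝔼 m} (hy₀ : y₀ ∈ Ω) :
    ∃ S : ShootingData Ω h, y₀ ∈ S.W := by
  obtain ⟨G, hGc, hG⟩ := hh.exists_velocity
  have : Nontrivial (𝔼 m) := by
    have : Nonempty (Fin m) := ⟨⟨0, hm⟩⟩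
    infer_instance
  obtain ⟨W, a, ρ, C, T, γ, hW, hyW, hρ, hT, hsub, hWa, hγ, hsurj, hanti, hzero, hcont⟩ :=
    exists_local_shooting (hΩ.prod isOpen_univ) (contDiffOn_hamVec hΩ hh.isFiberPoly.contDiffOn)
      (G := G) (y₀ := y₀) ⟨hy₀, mem_univ _⟩ (hGc.continuousAt (hΩ.mem_nhds hy₀)) (hG y₀ hy₀).1
      (fun z hz ↦ (hG z.1 hz.1).2 z.2) (fun y hy ↦ hh.hamVec_zero hΩ hy.1)
  refine ⟨⟨W, ρ, C, fun z ↦ γ z T, hW, fun y hy ↦ ?_, hρ, hsurj, hanti, hzero, hcont, ?_⟩, hyW⟩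
  · have hmem : (y, (0 : 𝔼 m)) ∈ closedBall (y₀, (0 : 𝔼 m)) a := by
      rw [← closedBall_prod_same]
      exact ⟨hWa hy, mem_closedBall_self (dist_nonneg.trans (hWa hy))⟩
    exact (hsub hmem).1
  · intro r s P Q P' Q' hPQ hPQ' y hy ξ hξ hagree
    obtain ⟨h0, hcurve⟩ := hγ y hy ξ hξ
    have := hPQ.cross_eq_of_integralCurve hPQ' hΩ hh.isFiberPoly
      (isCompact_closedBall (y₀, (0 : 𝔼 m)) a) hsub hT hcurve (hagree _)
    rwa [h0] at this

namespace ShootingData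

variable {Ω : Set (𝔼 m)} {h : 𝔼 m × 𝔼 m → ℝ} (S : ShootingData Ω h) {r s : ℕ}
  {P Q P' Q' : 𝔼 m × 𝔼 m → ℝ}

theorem continuousAt {y ξ : 𝔼 m} (hy : y ∈ S.W) (hξ : ξ ∈ ball (0 : 𝔼 m) S.rad) :
    ContinuousAt (fun z ↦ (S.Φ z).1) (y, ξ) :=
  continuousAt_fst.comp
    (S.continuousOn.continuousAt ((S.isOpen.prod isOpen_ball).mem_nhds ⟨hy, hξ⟩))

theorem isOpen_shoot {y : 𝔼 m} (hy : y ∈ S.W) {O : Set (𝔼 m)} (hO : IsOpen O) :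
    IsOpen {ξ | ξ ∈ ball (0 : 𝔼 m) S.rad ∧ (S.Φ (y, ξ)).1 ∈ O} := by
  have : ContinuousOn (fun ξ ↦ (S.Φ (y, ξ)).1) (ball (0 : 𝔼 m) S.rad) := fun ξ hξ ↦
    ((S.continuousAt hy hξ).comp (f := fun ξ : 𝔼 m ↦ (y, ξ))
      (Continuous.prodMk_right y).continuousAt).continuousWithinAt
  exact this.isOpen_inter_preimage isOpen_ball hO

/-- Unique continuation of first integrals. -/
theorem agreeAt_of_agree_on_isOpen (hPQ : IsLocalIntegral Ω h r s P Q)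
    (hPQ' : IsLocalIntegral Ω h r s P' Q') {O : Set (𝔼 m)} (hO : IsOpen O)
    (hne : (O ∩ S.W).Nonempty) (hagree : ∀ z ∈ O, AgreeAt P Q P' Q' z) {y : 𝔼 m}
    (hy : y ∈ S.W) : AgreeAt P Q P' Q' y := by
  obtain ⟨z, hzO, hzW⟩ := hne
  obtain ⟨ξ, hξ, hz⟩ := S.surj y hy z hzW
  exact hPQ.num.agreeAt_of_isOpen hPQ.den hPQ'.num hPQ'.den (S.subset hy)
    (S.isOpen_shoot hy hO) ⟨ξ, hξ, hz ▸ hzO⟩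
    fun ξ hξ ↦ S.transport hPQ hPQ' y hy ξ hξ.1 (hagree _ hξ.2)

/-- Shooting from `y` at coprime positions uses a dense set of momenta. -/
theorem subset_closure_coprime (hPQ : IsLocalIntegral Ω h r s P Q) {y : 𝔼 m} (hy : y ∈ S.W) :
    {ξ | ξ ∈ ball (0 : 𝔼 m) S.rad ∧ (S.Φ (y, ξ)).1 ∈ S.W} ⊆
      closure {ξ | ξ ∈ ball (0 : 𝔼 m) S.rad ∧ (S.Φ (y, ξ)).1 ∈ S.W ∧
        IsCoprimeFiber r s P Q (S.Φ (y, ξ)).1} := by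
  rintro ξ ⟨hξ, hz⟩
  rw [Metric.mem_closure_iff]
  intro ε hε
  have hcl := hPQ.coprime (S.subset hz)
  have hδ : 0 < ε / (|S.C| + 1) := by positivity
  obtain ⟨z, ⟨hzW, hzδ⟩, -, hzc⟩ := mem_closure_iff_nhds.1 hcl
    (S.W ∩ ball (S.Φ (y, ξ)).1 (ε / (|S.C| + 1)))
    (Filter.inter_mem (S.isOpen.mem_nhds hz) (ball_mem_nhds _ hδ))
  -- A coprime position near the end point is itself hit from $y$, and the inverse Lipschitz bound
  -- puts the momentum that hits it near $\xi$.
  obtain ⟨ζ, hζ, rfl⟩ := S.surj y hy z hzW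
  refine ⟨ζ, ⟨hζ, hzW, hzc⟩, ?_⟩
  rw [dist_eq_norm]
  have h1 := S.antilipschitz y hy ξ hξ ζ hζ
  rw [mem_ball', dist_eq_norm, lt_div_iff₀ (by positivity)] at hzδ
  calc ‖ξ - ζ‖ ≤ _ := h1
    _ ≤ (|S.C| + 1) * ‖(S.Φ (y, ξ)).1 - (S.Φ (y, ζ)).1‖ := by
      gcongr
      exact (le_abs_self _).trans (by linarith)
    _ < ε := by linarith

end ShootingData

/-- Finitely many values determine a first integral near a point: `n` values over each of `n`
positions, where `n` is the number of parameters of a fraction over one position. -/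
theorem IsLocalIntegral.exists_determining_values (hm : 1 ≤ m) {Ω : Set (𝔼 m)} (hΩ : IsOpen Ω)
    (hΩne : Ω.Nonempty) {h : 𝔼 m × 𝔼 m → ℝ} (hh : IsKinetic Ω h) {r s : ℕ}
    {P₀ Q₀ : 𝔼 m × 𝔼 m → ℝ} (hPQ₀ : IsLocalIntegral Ω h r s P₀ Q₀) :
    ∃ (y₀ : 𝔼 m) (p : Fin (fracDim m r s) → 𝔼 m) (y : Fin (fracDim m r s) → 𝔼 m)
      (q : Fin (fracDim m r s) → Fin (fracDim m r s) → 𝔼 m),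
      y₀ ∈ Ω ∧ (∀ k, y k ∈ Ω) ∧ IsTestFamily r s P₀ Q₀ y₀ p ∧
      (∀ k, IsTestFamily r s P₀ Q₀ (y k) (q k)) ∧ (∀ k j, Q₀ (y k, q k j) ≠ 0) ∧
      ∀ P Q P' Q' : 𝔼 m × 𝔼 m → ℝ, IsLocalIntegral Ω h r s P Q → IsLocalIntegral Ω h r s P' Q' →
        IsTestFamily r s P Q y₀ p → (∀ k, IsTestFamily r s P Q (y k) (q k)) →
        (∀ k j, P (y k, q k j) * Q' (y k, q k j) = P' (y k, q k j) * Q (y k, q k j)) →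
        ∀ᶠ y in 𝓝 y₀, AgreeAt P Q P' Q' y := by
  obtain ⟨z, hz⟩ := hΩne
  obtain ⟨S, hzS⟩ := hh.exists_shootingData hm hΩ hz
  obtain ⟨y₀, hy₀S, -, hy₀c⟩ := mem_closure_iff_nhds.1 (hPQ₀.coprime hz) S.W
    (S.isOpen.mem_nhds hzS)
  have h0 : (0 : 𝔼 m) ∈ ball (0 : 𝔼 m) S.rad := mem_ball_self S.rad_pos
  -- The test momenta over $y_0$ are drawn from those whose geodesics end at coprime positions, so
  -- that test families exist over the end positions too. Such momenta are dense in an open set that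
  -- contains $0$.
  obtain ⟨p, hpS, hp⟩ := hy₀c.exists_isTestFamily hm (S.isOpen_shoot hy₀S S.isOpen)
    ⟨0, h0, by rwa [S.map_zero y₀ hy₀S]⟩ (S.subset_closure_coprime hPQ₀ hy₀S)
  have hex : ∀ k, ∃ q : Fin (fracDim m r s) → 𝔼 m,
      (∀ j, Q₀ ((S.Φ (y₀, p k)).1, q j) ≠ 0) ∧
        IsTestFamily r s P₀ Q₀ (S.Φ (y₀, p k)).1 q := by
    intro k
    have hc := (hpS k).2.2
    obtain ⟨-, b, -, -, hb0, -, -, hb⟩ := id hc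
    have hop : IsOpen {ξ : 𝔼 m | Q₀ ((S.Φ (y₀, p k)).1, ξ) ≠ 0} := by
      simp only [hb]
      exact isOpen_ne_fun (continuous_evalAt b) continuous_const
    obtain ⟨ξ, -, hξ⟩ := exists_evalAt_ne_zero hb0 isOpen_univ univ_nonempty
    -- Drawing the momenta from the open set $Q_0\ne0$ makes the quotients $P_0/Q_0$ defined at all
    -- test points.
    exact hc.exists_isTestFamily hm hop ⟨ξ, by rwa [mem_ofPred_eq, hb]⟩ subset_closure
  choose q hq0 hq using hex
  refine ⟨y₀, p, fun k ↦ (S.Φ (y₀, p k)).1, q, S.subset hy₀S, fun k ↦ S.subset (hpS k).2.1, hp, hq,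
    hq0, fun P Q P' Q' hPQ hPQ' hp' hq' hval ↦ ?_⟩
  have hagree : ∀ k, AgreeAt P Q P' Q' (S.Φ (y₀, p k)).1 := by
    intro k
    obtain ⟨c, -, hc⟩ := (hq' k).exists_eq_mul hm (hPQ.isFiberFraction (S.subset (hpS k).2.1))
      (hPQ'.isFiberFraction (S.subset (hpS k).2.1)) (hval k)
    intro ξ
    rw [(hc ξ).1, (hc ξ).2]
    ring
  -- The end positions stay fixed while the initial position moves, so agreement over the same $n$
  -- fibres can be pulled back to every nearby $y$.
  have hshoot : ∀ y : 𝔼 m, ∃ ξ : Fin (fracDim m r s) → 𝔼 m, y ∈ S.W → ∀ k,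
      ξ k ∈ ball (0 : 𝔼 m) S.rad ∧ (S.Φ (y, ξ k)).1 = (S.Φ (y₀, p k)).1 := by
    intro y
    by_cases hy : y ∈ S.W
    · choose ξ hξ using fun k ↦ S.surj y hy _ (hpS k).2.1
      exact ⟨ξ, fun _ ↦ hξ⟩
    · exact ⟨0, fun h ↦ absurd h hy⟩
  choose ξ hξ using hshoot
  have hW : ∀ᶠ y in 𝓝 y₀, y ∈ S.W := S.isOpen.mem_nhds hy₀S
  have hlim : ∀ k, Filter.Tendsto (fun y ↦ ξ y k) (𝓝 y₀) (𝓝 (p k)) := by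
    intro k
    rw [tendsto_iff_norm_sub_tendsto_zero]
    have hc : Filter.Tendsto (fun y ↦ (S.Φ (y, p k)).1) (𝓝 y₀) (𝓝 (S.Φ (y₀, p k)).1) :=
      (S.continuousAt hy₀S (hpS k).1).tendsto.comp
        ((Continuous.prodMk_left (p k)).tendsto y₀)
    have hc' := ((tendsto_const_nhds (x := (S.Φ (y₀, p k)).1)).sub hc).norm.const_mul S.C
    rw [sub_self, norm_zero, mul_zero] at hc'
    refine squeeze_zero' (Filter.Eventually.of_forall fun _ ↦ norm_nonneg _) ?_ hc'
    filter_upwards [hW] with y hy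
    have := S.antilipschitz y hy _ (hξ y hy k).1 _ (hpS k).1
    rwa [(hξ y hy k).2] at this
  have hval : ∀ {f : 𝔼 m × 𝔼 m → ℝ} {d : ℕ}, IsFiberPoly Ω d f → ∀ k,
      Filter.Tendsto (fun y ↦ f (y, ξ y k)) (𝓝 y₀) (𝓝 (f (y₀, p k))) := fun hf k ↦
    (hf.continuousAt hΩ (S.subset hy₀S) (p k)).tendsto.comp
      (Filter.tendsto_id.prodMk_nhds (hlim k))
  -- The adjusted momenta tend to `p k`, so for $y$ near $y_0$ they still form a test family for
  -- $P/Q$.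
  filter_upwards [hW, IsTestFamily.eventually hp' (hval hPQ.num) (hval hPQ.den) hlim] with y hy ht
  obtain ⟨c, -, hc⟩ := IsTestFamily.exists_eq_mul hm ht (hPQ.isFiberFraction (S.subset hy))
    (hPQ'.isFiberFraction (S.subset hy)) (fun k ↦ S.transport hPQ hPQ' y hy _ (hξ y hy k).1 (by
      rw [(hξ y hy k).2]
      exact hagree k))
  intro ζ
  rw [(hc ζ).1, (hc ζ).2]
  ring

end LocalRigidity

/-! ### The metric and the Hamiltonian in canonical coordinates -/

section CanonicalCoordinates

variable {m : ℕ}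

/-- Nondegeneracy gives injectivity, and equality of dimensions makes $f$ an isomorphism, so
`inverse` is a genuine inverse here. -/
theorem inverse_apply_eq_of_nondegenerate {E : Type*} [NormedAddCommGroup E] [NormedSpace ℝ E]
    [FiniteDimensional ℝ E] (f : E →L[ℝ] E →L[ℝ] ℝ) (hf : ∀ v, (∀ w, f v w = 0) → v = 0) {v : E}
    {p : E →L[ℝ] ℝ} (h : f v = p) : f.inverse p = v := by
  have hinj : Function.Injective f := (injective_iff_map_eq_zero f).2 fun v hv ↦
    hf v fun w ↦ by rw [hv]; rfl
  have hrank : Module.finrank ℝ E = Module.finrank ℝ (E →L[ℝ] ℝ) := by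
    rw [← (LinearMap.toContinuousLinearMap (𝕜 := ℝ) (E := E) (F' := ℝ)).finrank_eq]
    exact (Subspace.dual_finrank_eq).symm
  let F : E ≃L[ℝ] (E →L[ℝ] ℝ) :=
    ((f : E →ₗ[ℝ] (E →L[ℝ] ℝ)).linearEquivOfInjective hinj hrank).toContinuousLinearEquiv
  have hF : f = (F : E →L[ℝ] (E →L[ℝ] ℝ)) := by
    ext v
    rfl
  rw [← h, hF, ContinuousLinearMap.inverse_equiv]
  exact F.symm_apply_apply v

variable {M : Type*} [TopologicalSpace M] [ChartedSpace (EuclideanSpace ℝ (Fin m)) M]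
  [IsManifold (𝓡 m) ∞ M]

/-- The linear isomorphism from a tangent space to the model space given by a chart. -/
theorem exists_tangentEquiv (x₀ : M) {x : M} (hx : x ∈ (chartAt (𝔼 m) x₀).source) :
    ∃ A : TangentSpace (𝓡 m) x ≃L[ℝ] 𝔼 m,
      (∀ v, mfderiv (𝓡 m) (𝓡 m) (chartAt (𝔼 m) x₀) x v = A v) ∧
      ∀ w, (trivializationAt (𝔼 m) (TangentSpace (𝓡 m)) x₀).symmL ℝ x w = A.symm w := by
  have h1 : IsManifold (𝓡 m) 1 M := IsManifold.of_le (n := ∞) (by norm_num)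
  set e := trivializationAt (𝔼 m) (TangentSpace (𝓡 m) (M := M)) x₀
  have hb : x ∈ e.baseSet := hx
  refine ⟨e.continuousLinearEquivAt ℝ x hb, fun v ↦ ?_, fun w ↦ ?_⟩
  · have := TangentBundle.continuousLinearMapAt_trivializationAt (𝕜 := ℝ) (I := 𝓡 m) hx
    have h2 := DFunLike.congr_fun this v
    exact h2.symm.trans (by
      rw [Bundle.Trivialization.continuousLinearEquivAt_apply]
      exact Bundle.Trivialization.continuousLinearMapAt_apply_of_mem ℝ e hb v)
  · exact (congrFun (e.symm_continuousLinearEquivAt_eq (R := ℝ) hb) w).symm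

theorem contMDiffOn_symmL_apply (x₀ : M) (w : 𝔼 m) :
    ContMDiffOn (𝓡 m) ((𝓡 m).prod 𝓘(ℝ, 𝔼 m)) ∞
      (fun x : M ↦ Bundle.TotalSpace.mk' (𝔼 m) (E := TangentSpace (𝓡 m) (M := M)) x
        ((trivializationAt (𝔼 m) (TangentSpace (𝓡 m)) x₀).symmL ℝ x w))
      (chartAt (𝔼 m) x₀).source := by
  have h1 : IsManifold (𝓡 m) (∞ + 1) M := inferInstanceAs (IsManifold (𝓡 m) ∞ M)
  set e := trivializationAt (𝔼 m) (TangentSpace (𝓡 m) (M := M)) x₀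
  refine (e.contMDiffOn_section_baseSet_iff (IB := 𝓡 m) (n := ∞)
    (s := fun x ↦ e.symmL ℝ x w)).2 ?_
  refine (contMDiffOn_const (c := w)).congr fun x hx ↦ ?_
  rw [e.symmL_apply hx, e.apply_mk_symm hx]

/-- The components of the metric in the coordinates of a chart are smooth. -/
theorem PseudoRiemannianMetric.contDiffOn_coord (g : PseudoRiemannianMetric m M) (x₀ : M)
    (u w : 𝔼 m) :
    ContDiffOn ℝ ∞ (fun y ↦ g.form ((chartAt (𝔼 m) x₀).symm y)
      ((trivializationAt (𝔼 m) (TangentSpace (𝓡 m)) x₀).symmL ℝ ((chartAt (𝔼 m) x₀).symm y) u)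
      ((trivializationAt (𝔼 m) (TangentSpace (𝓡 m)) x₀).symmL ℝ ((chartAt (𝔼 m) x₀).symm y) w))
      (chartAt (𝔼 m) x₀).target := by
  have h1 : ContMDiffOn (𝓡 m) 𝓘(ℝ) ∞ (fun x ↦ g.form x
      ((trivializationAt (𝔼 m) (TangentSpace (𝓡 m)) x₀).symmL ℝ x u)
      ((trivializationAt (𝔼 m) (TangentSpace (𝓡 m)) x₀).symmL ℝ x w))
      (chartAt (𝔼 m) x₀).source := by
    intro x hx
    have h2 : ContMDiffWithinAt (𝓡 m) ((𝓡 m).prod 𝓘(ℝ)) ∞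
        (fun x ↦ Bundle.TotalSpace.mk' ℝ (E := Bundle.Trivial M ℝ) x (g.form x
          ((trivializationAt (𝔼 m) (TangentSpace (𝓡 m)) x₀).symmL ℝ x u)
          ((trivializationAt (𝔼 m) (TangentSpace (𝓡 m)) x₀).symmL ℝ x w)))
        (chartAt (𝔼 m) x₀).source x := by
      apply ContMDiffWithinAt.clm_bundle_apply₂ (F₁ := 𝔼 m) (F₂ := 𝔼 m)
      · exact g.contMDiff.contMDiffAt.contMDiffWithinAt
      · exact contMDiffOn_symmL_apply x₀ u x hx
      · exact contMDiffOn_symmL_apply x₀ w x hx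
    simp only [Bundle.contMDiffWithinAt_totalSpace] at h2
    exact h2.2
  have h2 : ContMDiffOn (𝓡 m) (𝓡 m) ∞ (chartAt (𝔼 m) x₀).symm (chartAt (𝔼 m) x₀).target :=
    contMDiffOn_chart_symm
  exact (h1.comp h2 fun y hy ↦ (chartAt (𝔼 m) x₀).map_target hy).contDiffOn

/-- The metric over the point with coordinates `y`, as an operator on the model space. -/
def PseudoRiemannianMetric.coordOp (g : PseudoRiemannianMetric m M) (x₀ : M) (y : 𝔼 m) :
    𝔼 m →L[ℝ] 𝔼 m :=
  LinearMap.toContinuousLinearMap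
    { toFun := fun u ↦ WithLp.toLp 2 fun j ↦ g.form ((chartAt (𝔼 m) x₀).symm y)
        ((trivializationAt (𝔼 m) (TangentSpace (𝓡 m)) x₀).symmL ℝ ((chartAt (𝔼 m) x₀).symm y) u)
        ((trivializationAt (𝔼 m) (TangentSpace (𝓡 m)) x₀).symmL ℝ ((chartAt (𝔼 m) x₀).symm y)
          (EuclideanSpace.single j 1))
      map_add' := fun u v ↦ by
        ext j
        simp only [map_add, PiLp.add_apply]
        rfl
      map_smul' := fun c u ↦ by
        ext j
        simp only [map_smul, PiLp.smul_apply]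
        rfl }

theorem PseudoRiemannianMetric.inner_coordOp (g : PseudoRiemannianMetric m M) (x₀ : M)
    (y u w : 𝔼 m) :
    inner ℝ (g.coordOp x₀ y u) w = g.form ((chartAt (𝔼 m) x₀).symm y)
      ((trivializationAt (𝔼 m) (TangentSpace (𝓡 m)) x₀).symmL ℝ ((chartAt (𝔼 m) x₀).symm y) u)
      ((trivializationAt (𝔼 m) (TangentSpace (𝓡 m)) x₀).symmL ℝ ((chartAt (𝔼 m) x₀).symm y) w)
    := by
  set B := (trivializationAt (𝔼 m) (TangentSpace (𝓡 m)) x₀).symmL ℝ ((chartAt (𝔼 m) x₀).symm y)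
  have hw : w = ∑ j, w j • EuclideanSpace.single j (1 : ℝ) := by
    ext i
    simp [Pi.single_apply]
  have h1 : ∀ j, inner ℝ (g.coordOp x₀ y u) (EuclideanSpace.single j (1 : ℝ)) =
      g.form ((chartAt (𝔼 m) x₀).symm y) (B u) (B (EuclideanSpace.single j 1)) := by
    intro j
    rw [EuclideanSpace.inner_single_right]
    simp [coordOp, B]
  rw [hw]
  simp only [inner_sum, inner_smul_right, h1, map_sum, map_smul, smul_eq_mul]

theorem PseudoRiemannianMetric.contDiffOn_coordOp (g : PseudoRiemannianMetric m M) (x₀ : M) :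
    ContDiffOn ℝ ∞ (g.coordOp x₀) (chartAt (𝔼 m) x₀).target := by
  rw [contDiffOn_clm_apply]
  intro u
  rw [contDiffOn_euclidean]
  intro j
  exact g.contDiffOn_coord x₀ u _

theorem PseudoRiemannianMetric.isInvertible_coordOp (g : PseudoRiemannianMetric m M) (x₀ : M)
    {y : 𝔼 m} (hy : y ∈ (chartAt (𝔼 m) x₀).target) : (g.coordOp x₀ y).IsInvertible := by
  obtain ⟨A, -, hA⟩ := exists_tangentEquiv x₀ ((chartAt (𝔼 m) x₀).map_target hy)
  have hinj : Function.Injective (g.coordOp x₀ y) := by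
    refine (injective_iff_map_eq_zero _).2 fun u hu ↦ ?_
    have : A.symm u = 0 := by
      refine g.nondegenerate _ _ fun w ↦ ?_
      have := g.inner_coordOp x₀ y u (A w)
      rwa [hu, inner_zero_left, hA, hA, A.symm_apply_apply, eq_comm] at this
    simpa using this
  refine ⟨(LinearEquiv.ofInjectiveEndo (g.coordOp x₀ y : 𝔼 m →ₗ[ℝ] 𝔼 m)
    hinj).toContinuousLinearEquiv, ?_⟩
  ext v
  rfl

/-- The Hamiltonian in canonical coordinates. -/
theorem PseudoRiemannianMetric.inCoords_hamiltonian (g : PseudoRiemannianMetric m M) (x₀ : M)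
    {y : 𝔼 m} (hy : y ∈ (chartAt (𝔼 m) x₀).target) (ξ : 𝔼 m) :
    inCoords g.hamiltonian (chartAt (𝔼 m) x₀) (y, ξ) =
      1 / 2 * inner ℝ ξ ((g.coordOp x₀ y).inverse ξ) := by
  obtain ⟨A, hA', hA⟩ := exists_tangentEquiv x₀ ((chartAt (𝔼 m) x₀).map_target hy)
  have hinv := g.isInvertible_coordOp x₀ hy
  set p := coordCovector (chartAt (𝔼 m) x₀) y ξ with hp
  have hpv : ∀ v, p v = inner ℝ ξ (A v) := by
    intro v
    rw [← hA' v]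
    rfl
  have hform : g.form ((chartAt (𝔼 m) x₀).symm y) (A.symm ((g.coordOp x₀ y).inverse ξ)) = p := by
    ext w
    have h1 := g.inner_coordOp x₀ y ((g.coordOp x₀ y).inverse ξ) (A w)
    rw [hA, hA, A.symm_apply_apply, hinv.self_apply_inverse] at h1
    rw [hpv, ← h1]
  have hinverse : (g.form ((chartAt (𝔼 m) x₀).symm y)).inverse p =
      A.symm ((g.coordOp x₀ y).inverse ξ) :=
    inverse_apply_eq_of_nondegenerate (E := 𝔼 m) (g.form ((chartAt (𝔼 m) x₀).symm y))
      (g.nondegenerate _) hform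
  have : inCoords g.hamiltonian (chartAt (𝔼 m) x₀) (y, ξ) =
      1 / 2 * p ((g.form ((chartAt (𝔼 m) x₀).symm y)).inverse p) := rfl
  rw [this, hinverse, hpv, A.apply_symm_apply]

end CanonicalCoordinates

/-! ### Passage between the manifold and its charts; unique continuation -/

section Transfer

variable {m : ℕ}

/-- By symmetry of $G$, the momentum gradient of $\frac12\langle\xi,G(y)\xi\rangle$ is $G(y)\xi$, so
$G$ itself is the velocity operator. -/
theorem IsKinetic.of_quadratic {Ω : Set (𝔼 m)} (hΩ : IsOpen Ω) {h : 𝔼 m × 𝔼 m → ℝ}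
    {G : 𝔼 m → 𝔼 m →L[ℝ] 𝔼 m} (hG : ContDiffOn ℝ ∞ G Ω) (hinv : ∀ y ∈ Ω, (G y).IsInvertible)
    (hsymm : ∀ y ∈ Ω, ∀ u w, inner ℝ (G y u) w = (inner ℝ u (G y w) : ℝ))
    (hh : ∀ y ∈ Ω, ∀ ξ, h (y, ξ) = 1 / 2 * inner ℝ ξ (G y ξ)) : IsKinetic Ω h := by
  have hsmooth : ContDiffOn ℝ ∞ h (Ω ×ˢ univ) := by
    have h1 : ContDiffOn ℝ ∞ (fun z : 𝔼 m × 𝔼 m ↦ (1 / 2 : ℝ) * inner ℝ z.2 (G z.1 z.2))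
        (Ω ×ˢ univ) := by
      have hG' : ContDiffOn ℝ ∞ (fun z : 𝔼 m × 𝔼 m ↦ G z.1) (Ω ×ˢ univ) :=
        hG.comp contDiffOn_fst fun z hz ↦ hz.1
      exact contDiffOn_const.mul (contDiffOn_snd.inner ℝ (hG'.clm_apply contDiffOn_snd))
    exact h1.congr fun z hz ↦ hh z.1 hz.1 z.2
  have hpoly : IsFiberPoly Ω 2 h := by
    refine ⟨hsmooth, fun y hy ↦ ⟨∑ i, ∑ j, MvPolynomial.C
      (1 / 2 * G y (EuclideanSpace.single j 1) i) * (MvPolynomial.X i * MvPolynomial.X j),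
      MvPolynomial.IsHomogeneous.sum _ _ _ fun i _ ↦ MvPolynomial.IsHomogeneous.sum _ _ _
        fun j _ ↦ ((MvPolynomial.isHomogeneous_X ℝ i).mul
          (MvPolynomial.isHomogeneous_X ℝ j)).C_mul _, fun ξ ↦ ?_⟩⟩
    have hξ : G y ξ = ∑ j, ξ j • G y (EuclideanSpace.single j (1 : ℝ)) := by
      have : ξ = ∑ j, ξ j • EuclideanSpace.single j (1 : ℝ) := by
        ext i
        simp [Pi.single_apply]
      conv_lhs => rw [this]
      simp only [map_sum, map_smul]
    rw [hh y hy, hξ, PiLp.inner_apply]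
    simp only [evalAt, map_sum, map_mul, MvPolynomial.eval_C, MvPolynomial.eval_X,
      Real.inner_apply, WithLp.ofLp_sum, Finset.sum_apply, PiLp.smul_apply, smul_eq_mul,
      Finset.mul_sum]
    refine Finset.sum_congr rfl fun i _ ↦ Finset.sum_congr rfl fun j _ ↦ ?_
    ring
  refine ⟨hpoly, G, hG.continuousOn, fun y hy ↦ ⟨hinv y hy, fun ξ ↦ ?_⟩⟩
  have hd : ∀ v, fderiv ℝ h (y, ξ) (0, v) = inner ℝ (G y ξ) v := by
    intro v
    have h1 := (hpoly.differentiableAt hΩ hy ξ).hasFDerivAt.comp ξ (hasFDerivAt_prodMk_right y ξ)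
    have h2 : HasFDerivAt (fun ξ ↦ h (y, ξ)) _ ξ :=
      (((hasFDerivAt_id ξ).inner ℝ (G y).hasFDerivAt).const_mul (1 / 2 : ℝ)).congr_of_eventuallyEq
        (Filter.Eventually.of_forall (hh y hy))
    have h3 := DFunLike.congr_fun (h1.unique h2) v
    simp [fderivInnerCLM_apply] at h3
    rw [h3, ← hsymm y hy, real_inner_comm (G y ξ) v]
    ring
  have h2 : (hamVec h (y, ξ)).1 = ∑ i, G y ξ i • EuclideanSpace.single i (1 : ℝ) := by
    simp only [hamVec, hd, EuclideanSpace.inner_single_right]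
    simp
  rw [h2]
  ext i
  simp [Pi.single_apply]

/-- Substitution of a linear map in a polynomial. -/
def linSubst (L : 𝔼 m →ₗ[ℝ] 𝔼 m) : MvPolynomial (Fin m) ℝ →ₐ[ℝ] MvPolynomial (Fin m) ℝ :=
  MvPolynomial.aeval fun i ↦ ∑ j, MvPolynomial.C (L (EuclideanSpace.single j 1) i) *
    MvPolynomial.X j

theorem evalAt_linSubst (L : 𝔼 m →ₗ[ℝ] 𝔼 m) (p : MvPolynomial (Fin m) ℝ) (ξ : 𝔼 m) :
    evalAt (linSubst L p) ξ = evalAt p (L ξ) := by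
  have hξ : ∀ i, L ξ i = ∑ j, L (EuclideanSpace.single j 1) i * ξ j := by
    intro i
    have : ξ = ∑ j, ξ j • EuclideanSpace.single j (1 : ℝ) := by
      ext i
      simp [Pi.single_apply]
    conv_lhs => rw [this]
    simp [mul_comm]
  simp only [evalAt, linSubst, hξ]
  induction p using MvPolynomial.induction_on with
  | C a => simp
  | add p q hp hq => simp only [map_add, hp, hq]
  | mul_X p i hp => simp only [map_mul, hp, MvPolynomial.aeval_X, map_sum, MvPolynomial.eval_C,
      MvPolynomial.eval_X]

theorem isHomogeneous_linSubst (L : 𝔼 m →ₗ[ℝ] 𝔼 m) {p : MvPolynomial (Fin m) ℝ} {d : ℕ}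
    (hp : p.IsHomogeneous d) : (linSubst L p).IsHomogeneous d := by
  have := hp.aeval (S := ℝ) (n := 1) (fun i ↦ ∑ j, MvPolynomial.C
    (L (EuclideanSpace.single j 1) i) * MvPolynomial.X j) fun i ↦
      MvPolynomial.IsHomogeneous.sum _ _ _ fun j _ ↦ (MvPolynomial.isHomogeneous_X ℝ j).C_mul _
  rwa [one_mul] at this

theorem linSubst_linSubst (L : 𝔼 m ≃ₗ[ℝ] 𝔼 m) (p : MvPolynomial (Fin m) ℝ) :
    linSubst (L : 𝔼 m →ₗ[ℝ] 𝔼 m) (linSubst (L.symm : 𝔼 m →ₗ[ℝ] 𝔼 m) p) = p := by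
  refine evalAt_injective (funext fun ξ ↦ ?_)
  rw [evalAt_linSubst, evalAt_linSubst]
  simp

theorem isRelPrime_linSubst (L : 𝔼 m ≃ₗ[ℝ] 𝔼 m) {p q : MvPolynomial (Fin m) ℝ}
    (h : IsRelPrime p q) :
    IsRelPrime (linSubst (L : 𝔼 m →ₗ[ℝ] 𝔼 m) p) (linSubst (L : 𝔼 m →ₗ[ℝ] 𝔼 m) q) := by
  intro d hp hq
  have hback : ∀ p, linSubst (L.symm : 𝔼 m →ₗ[ℝ] 𝔼 m) (linSubst (L : 𝔼 m →ₗ[ℝ] 𝔼 m) p) = p :=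
    fun p ↦ linSubst_linSubst L.symm p
  have h1 := map_dvd (linSubst (L.symm : 𝔼 m →ₗ[ℝ] 𝔼 m)) hp
  have h2 := map_dvd (linSubst (L.symm : 𝔼 m →ₗ[ℝ] 𝔼 m)) hq
  rw [hback] at h1 h2
  have := (h h1 h2).map (linSubst (L : 𝔼 m →ₗ[ℝ] 𝔼 m))
  rwa [linSubst_linSubst] at this

theorem linSubst_ne_zero (L : 𝔼 m ≃ₗ[ℝ] 𝔼 m) {p : MvPolynomial (Fin m) ℝ} (hp : p ≠ 0) :
    linSubst (L : 𝔼 m →ₗ[ℝ] 𝔼 m) p ≠ 0 := by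
  intro h
  have := linSubst_linSubst L.symm p
  rw [LinearEquiv.symm_symm, h, map_zero] at this
  exact hp this.symm

variable {M : Type*} [TopologicalSpace M] [ChartedSpace (EuclideanSpace ℝ (Fin m)) M]
  [IsManifold (𝓡 m) ∞ M]

theorem PseudoRiemannianMetric.isKinetic (g : PseudoRiemannianMetric m M) (x₀ : M) :
    IsKinetic (chartAt (𝔼 m) x₀).target (inCoords g.hamiltonian (chartAt (𝔼 m) x₀)) := by
  refine IsKinetic.of_quadratic (chartAt (𝔼 m) x₀).open_target
    (G := fun y ↦ (g.coordOp x₀ y).inverse) (fun y hy ↦ ?_) (fun y hy ↦ ?_) (fun y hy u w ↦ ?_)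
    fun y hy ξ ↦ g.inCoords_hamiltonian x₀ hy ξ
  · obtain ⟨F, hF⟩ := g.isInvertible_coordOp x₀ hy
    have h1 : ContDiffAt ℝ ∞ ContinuousLinearMap.inverse (g.coordOp x₀ y) := by
      rw [← hF]
      exact contDiffAt_map_inverse F
    exact h1.comp_contDiffWithinAt y (g.contDiffOn_coordOp x₀ y hy)
  · exact (g.isInvertible_coordOp x₀ hy).inverse
  · have hinv := g.isInvertible_coordOp x₀ hy
    have hS : ∀ a b : 𝔼 m, (inner ℝ (g.coordOp x₀ y a) b : ℝ) = inner ℝ a (g.coordOp x₀ y b) := by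
      intro a b
      rw [g.inner_coordOp, g.symm, ← g.inner_coordOp, real_inner_comm]
    have := hS ((g.coordOp x₀ y).inverse u) ((g.coordOp x₀ y).inverse w)
    rw [hinv.self_apply_inverse, hinv.self_apply_inverse] at this
    exact this.symm

/-- The components of a covector depend on its canonical momenta through a linear isomorphism. -/
theorem exists_components_coordCovector (x₀ : M) {y : 𝔼 m}
    (hy : y ∈ (chartAt (𝔼 m) x₀).target) : ∃ L : 𝔼 m ≃ₗ[ℝ] 𝔼 m, ∀ ξ i,
      components ((chartAt (𝔼 m) x₀).symm y) (coordCovector (chartAt (𝔼 m) x₀) y ξ) i = L ξ i := by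
  obtain ⟨A, hA, -⟩ := exists_tangentEquiv x₀ ((chartAt (𝔼 m) x₀).map_target hy)
  let A' : 𝔼 m →L[ℝ] 𝔼 m :=
    (A : TangentSpace (𝓡 m) ((chartAt (𝔼 m) x₀).symm y) →L[ℝ] 𝔼 m)
  let b : Fin m → 𝔼 m := fun i ↦ A' (EuclideanSpace.single i 1)
  have hb : ∀ ξ i, components ((chartAt (𝔼 m) x₀).symm y)
      (coordCovector (chartAt (𝔼 m) x₀) y ξ) i = inner ℝ ξ (b i) := fun ξ i ↦
    congrArg (inner ℝ ξ) (hA _)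
  let L : 𝔼 m →ₗ[ℝ] 𝔼 m :=
    { toFun := fun ξ ↦ WithLp.toLp 2 fun i ↦ inner ℝ ξ (b i)
      map_add' := fun ξ ζ ↦ by ext i; simp [inner_add_left]
      map_smul' := fun c ξ ↦ by ext i; simp [inner_smul_left] }
  have hL : Function.Injective L := by
    refine (injective_iff_map_eq_zero L).2 fun ξ hξ ↦ ?_
    have h0 : ∀ i, (inner ℝ ξ (b i) : ℝ) = 0 := fun i ↦ congrArg (fun v : 𝔼 m ↦ v i) hξ
    have h1 : ∀ v : 𝔼 m, (inner ℝ ξ (A' v) : ℝ) = 0 := by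
      intro v
      have hv : v = ∑ j, v j • EuclideanSpace.single j (1 : ℝ) := by
        ext i
        simp [Pi.single_apply]
      rw [hv, map_sum, inner_sum]
      simp only [map_smul, inner_smul_right]
      exact Finset.sum_eq_zero fun j _ ↦ mul_eq_zero_of_right _ (h0 j)
    have h2 := h1 (A.symm ξ)
    exact inner_self_eq_zero.1 ((congrArg (inner ℝ ξ) (A.apply_symm_apply ξ)).symm.trans h2)
  exact ⟨LinearEquiv.ofInjectiveEndo L hL, fun ξ i ↦ hb ξ i⟩

/-- A momentum polynomial in canonical coordinates. -/
theorem exists_linSubst_inCoords (x₀ : M) {y : 𝔼 m} (hy : y ∈ (chartAt (𝔼 m) x₀).target) :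
    ∃ L : 𝔼 m ≃ₗ[ℝ] 𝔼 m, ∀ (d : ℕ) (P : MomentumPoly m M d) (ξ : 𝔼 m),
      inCoords P.toFun (chartAt (𝔼 m) x₀) (y, ξ) =
        evalAt (linSubst (L : 𝔼 m →ₗ[ℝ] 𝔼 m) (P.poly ((chartAt (𝔼 m) x₀).symm y))) ξ := by
  obtain ⟨L, hL⟩ := exists_components_coordCovector x₀ hy
  refine ⟨L, fun d P ξ ↦ ?_⟩
  rw [evalAt_linSubst]
  have : components ((chartAt (𝔼 m) x₀).symm y) (coordCovector (chartAt (𝔼 m) x₀) y ξ) =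
    fun i ↦ L ξ i := funext (hL ξ)
  simp only [inCoords, MomentumPoly.toFun, this]
  rfl

theorem MomentumPoly.isFiberPoly {d : ℕ} (P : MomentumPoly m M d) (x₀ : M) :
    IsFiberPoly (chartAt (𝔼 m) x₀).target d (inCoords P.toFun (chartAt (𝔼 m) x₀)) := by
  refine ⟨P.smooth _ (chart_mem_atlas _ x₀), fun y hy ↦ ?_⟩
  obtain ⟨L, hL⟩ := exists_linSubst_inCoords x₀ hy
  exact ⟨_, isHomogeneous_linSubst _ (P.homogeneous _), hL d P⟩

variable {g : PseudoRiemannianMetric m M} {r s : ℕ}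

theorem IntegralFraction.isLocalIntegral (F : IntegralFraction g r s) (x₀ : M) :
    IsLocalIntegral (chartAt (𝔼 m) x₀).target (inCoords g.hamiltonian (chartAt (𝔼 m) x₀)) r s
      (inCoords F.num.toFun (chartAt (𝔼 m) x₀)) (inCoords F.den.toFun (chartAt (𝔼 m) x₀)) where
  num := F.num.isFiberPoly x₀
  den := F.den.isFiberPoly x₀
  coprime y hy := by
    set e := chartAt (𝔼 m) x₀
    rw [_root_.mem_closure_iff]
    intro N hN hyN
    obtain ⟨x, ⟨hxe, hxN⟩, hx0, hx⟩ := F.relPrime.inter_open_nonempty (e.source ∩ e ⁻¹' N)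
      (e.isOpen_inter_preimage hN)
      ⟨e.symm y, e.map_target hy, by rwa [mem_preimage, e.right_inv hy]⟩
    obtain ⟨L, hL⟩ := exists_linSubst_inCoords x₀ (e.map_source hxe)
    have hex : e.symm (e x) = x := e.left_inv hxe
    refine ⟨e x, hxN, e.map_source hxe, _, _, isHomogeneous_linSubst _ (F.num.homogeneous _),
      isHomogeneous_linSubst _ (F.den.homogeneous _), linSubst_ne_zero L ?_,
      isRelPrime_linSubst L ?_, hL r F.num, hL s F.den⟩
    · exact (congrArg F.den.poly hex).trans_ne hx0
    · change IsRelPrime (F.num.poly (e.symm (e x))) (F.den.poly (e.symm (e x)))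
      rwa [hex]
  not_both_zero y hy := by
    obtain ⟨L, hL⟩ := exists_linSubst_inCoords x₀ hy
    simp only [hL]
    rcases F.not_both_zero ((chartAt (𝔼 m) x₀).symm y) with h | h
    · obtain ⟨ξ, -, hξ⟩ := exists_evalAt_ne_zero (linSubst_ne_zero L h) isOpen_univ univ_nonempty
      exact ⟨ξ, Or.inl hξ⟩
    · obtain ⟨ξ, -, hξ⟩ := exists_evalAt_ne_zero (linSubst_ne_zero L h) isOpen_univ univ_nonempty
      exact ⟨ξ, Or.inr hξ⟩
  bracket y hy ξ hQ := F.involution _ (chart_mem_atlas _ x₀) y hy ξ hQ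

/-- Agreement of two fractions over a point, in the coordinates of a chart. -/
theorem IntegralFraction.agreeAt_iff (F G : IntegralFraction g r s) (x₀ : M) {y : 𝔼 m}
    (hy : y ∈ (chartAt (𝔼 m) x₀).target) :
    AgreeAt (inCoords F.num.toFun (chartAt (𝔼 m) x₀)) (inCoords F.den.toFun (chartAt (𝔼 m) x₀))
      (inCoords G.num.toFun (chartAt (𝔼 m) x₀)) (inCoords G.den.toFun (chartAt (𝔼 m) x₀)) y ↔
    F.num.poly ((chartAt (𝔼 m) x₀).symm y) * G.den.poly ((chartAt (𝔼 m) x₀).symm y) =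
      G.num.poly ((chartAt (𝔼 m) x₀).symm y) * F.den.poly ((chartAt (𝔼 m) x₀).symm y) := by
  obtain ⟨L, hL⟩ := exists_linSubst_inCoords x₀ hy
  simp only [AgreeAt, hL, evalAt_linSubst, ← evalAt_mul]
  constructor
  · intro h
    refine evalAt_injective (funext fun ξ ↦ ?_)
    have := h (L.symm ξ)
    rwa [LinearEquiv.coe_coe, L.apply_symm_apply] at this
  · intro h ξ
    rw [h]

/-- Two rational integrals that agree over a nonempty open set are equal. -/
theorem IntegralFraction.equiv_of_agree_on_isOpen [ConnectedSpace M] (hm : 1 ≤ m)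
    (F G : IntegralFraction g r s) {O : Set M} (hO : IsOpen O) (hne : O.Nonempty)
    (h : ∀ x ∈ O, F.num.poly x * G.den.poly x = G.num.poly x * F.den.poly x) : F ≈ G := by
  set A : Set M := interior {x | F.num.poly x * G.den.poly x = G.num.poly x * F.den.poly x}
  have hsub : A ⊆ {x | F.num.poly x * G.den.poly x = G.num.poly x * F.den.poly x} :=
    interior_subset
  have hA : IsClopen A := by
    -- Every position of a shooting neighbourhood of a limit point reaches the open set of agreement
    -- inside it, so agreement fills that neighbourhood.
    refine ⟨isClosed_of_closure_subset fun x₀ hx₀ ↦ ?_, isOpen_interior⟩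
    set e := chartAt (𝔼 m) x₀
    have hxe : x₀ ∈ e.source := mem_chart_source _ x₀
    obtain ⟨S, hS⟩ := (g.isKinetic x₀).exists_shootingData hm e.open_target (e.map_source hxe)
    have hW : IsOpen (e.source ∩ e ⁻¹' S.W) := e.isOpen_inter_preimage S.isOpen
    obtain ⟨x, ⟨hxs, hxW⟩, hxA⟩ := _root_.mem_closure_iff.1 hx₀ _ hW ⟨hxe, hS⟩
    have hOe : IsOpen (e.target ∩ e.symm ⁻¹' A) := e.symm.isOpen_inter_preimage isOpen_interior
    have hagree : ∀ y ∈ S.W, AgreeAt (inCoords F.num.toFun e) (inCoords F.den.toFun e)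
        (inCoords G.num.toFun e) (inCoords G.den.toFun e) y := fun y hy ↦
      S.agreeAt_of_agree_on_isOpen (F.isLocalIntegral x₀) (G.isLocalIntegral x₀) hOe
        ⟨e x, ⟨e.map_source hxs, by rwa [mem_preimage, e.left_inv hxs]⟩, hxW⟩
        (fun z hz ↦ (F.agreeAt_iff G x₀ hz.1).2 (hsub hz.2)) hy
    refine mem_interior.2 ⟨_, fun x hx ↦ ?_, hW, hxe, hS⟩
    have := (F.agreeAt_iff G x₀ (S.subset hx.2)).1 (hagree _ hx.2)
    have hex : e.symm (e x) = x := e.left_inv hx.1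
    rw [hex] at this
    exact this
  have hAne : A.Nonempty := hne.mono (interior_maximal h hO)
  have := hA.eq_univ hAne
  intro x
  exact hsub (this ▸ mem_univ x : x ∈ A)

end Transfer

/-! ### The local parameters on the space of rational integrals -/

section FiniteDimensionality

variable {m : ℕ} {M : Type*} [TopologicalSpace M] [ChartedSpace (EuclideanSpace ℝ (Fin m)) M]
  [IsManifold (𝓡 m) ∞ M] {g : PseudoRiemannianMetric m M} {r s : ℕ}

namespace IntegralFraction

/-- The numerator in canonical coordinates. -/
abbrev coordNum (F : IntegralFraction g r s) (x₀ : M) : 𝔼 m × 𝔼 m → ℝ :=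
  inCoords F.num.toFun (chartAt (𝔼 m) x₀)

/-- The denominator in canonical coordinates. -/
abbrev coordDen (F : IntegralFraction g r s) (x₀ : M) : 𝔼 m × 𝔼 m → ℝ :=
  inCoords F.den.toFun (chartAt (𝔼 m) x₀)

theorem continuous_coord (x₀ : M) (z : 𝔼 m × 𝔼 m) :
    Continuous (fun F : IntegralFraction g r s ↦ F.coordNum x₀ z) ∧
      Continuous fun F : IntegralFraction g r s ↦ F.coordDen x₀ z := by
  have h₀ : Continuous fun (F : IntegralFraction g r s) (z : Σ x : M, Covector (m := m) x) ↦
      (F.num.toFun z.1 z.2, F.den.toFun z.1 z.2) := continuous_induced_dom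
  have h : Continuous fun F : IntegralFraction g r s ↦
      ((F.coordNum x₀ z, F.coordDen x₀ z) : ℝ × ℝ) :=
    (continuous_apply (A := fun _ : Σ x : M, Covector (m := m) x ↦ ℝ × ℝ)
      ⟨(chartAt (𝔼 m) x₀).symm z.1, coordCovector (chartAt (𝔼 m) x₀) z.1 z.2⟩).comp h₀
  exact ⟨h.fst, h.snd⟩

theorem isOpen_isTestFamily (x₀ : M) {n : ℕ} (y : 𝔼 m) (x : Fin n → 𝔼 m) :
    IsOpen {F : IntegralFraction g r s | IsTestFamily r s (F.coordNum x₀) (F.coordDen x₀) y x} :=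
  isOpen_iff_eventually.2 fun _ hF ↦ IsTestFamily.eventually hF
    (fun _ ↦ (continuous_coord x₀ _).1.continuousAt)
    (fun _ ↦ (continuous_coord x₀ _).2.continuousAt) fun _ ↦ tendsto_const_nhds

theorem agreeAt_of_equiv {F G : IntegralFraction g r s} (h : F ≈ G) (x₀ : M) {y : 𝔼 m}
    (hy : y ∈ (chartAt (𝔼 m) x₀).target) :
    AgreeAt (F.coordNum x₀) (F.coordDen x₀) (G.coordNum x₀) (G.coordDen x₀) y :=
  (F.agreeAt_iff G x₀ hy).2 (h _)

/-- Equivalent fractions may differ by a common factor of numerator and denominator. Over a position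
with a test family it can only be a nonzero constant, which makes the open conditions below
independent of the representative. -/
theorem exists_coord_eq_mul (hm : 1 ≤ m) {F G : IntegralFraction g r s} (h : F ≈ G) (x₀ : M)
    {y : 𝔼 m} (hy : y ∈ (chartAt (𝔼 m) x₀).target) {x : Fin (fracDim m r s) → 𝔼 m}
    (hx : IsTestFamily r s (F.coordNum x₀) (F.coordDen x₀) y x) :
    ∃ c : ℝ, c ≠ 0 ∧ ∀ ξ, G.coordNum x₀ (y, ξ) = c * F.coordNum x₀ (y, ξ) ∧
      G.coordDen x₀ (y, ξ) = c * F.coordDen x₀ (y, ξ) :=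
  hx.exists_eq_mul hm ((F.isLocalIntegral x₀).isFiberFraction hy)
    ((G.isLocalIntegral x₀).isFiberFraction hy) fun _ ↦ agreeAt_of_equiv h x₀ hy _

end IntegralFraction

theorem dimensionAtMost_rationalIntegrals [T2Space M] [ConnectedSpace M] (hm : 1 ≤ m) :
    DimensionAtMost (RationalIntegrals g r s) (fracDim m r s ^ 2) := by
  let π : IntegralFraction g r s → RationalIntegrals g r s := Quotient.mk _
  have hπ : IsQuotientMap π := isQuotientMap_quot_mk
  have hrel : ∀ F G : IntegralFraction g r s, π F = π G ↔ F ≈ G := fun F G ↦ Quotient.eq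
  intro a
  obtain ⟨F₀, rfl⟩ := hπ.surjective a
  obtain ⟨x₀⟩ : Nonempty M := inferInstance
  set e := chartAt (EuclideanSpace ℝ (Fin m)) x₀
  obtain ⟨y₀, p, y, q, hy₀, hy, hp₀, hq₀, hQ₀, hdet⟩ :=
    (F₀.isLocalIntegral x₀).exists_determining_values hm e.open_target
      ⟨_, e.map_source (mem_chart_source _ x₀)⟩ (g.isKinetic x₀)
  let U' : Set (IntegralFraction g r s) :=
    {F | IsTestFamily r s (F.coordNum x₀) (F.coordDen x₀) y₀ p} ∩
      ((⋂ k, {F | IsTestFamily r s (F.coordNum x₀) (F.coordDen x₀) (y k) (q k)}) ∩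
        ⋂ k, ⋂ j, {F | F.coordDen x₀ (y k, q k j) ≠ 0})
  have hU' : IsOpen U' :=
    (IntegralFraction.isOpen_isTestFamily x₀ y₀ p).inter
      ((isOpen_iInter_of_finite fun k ↦ IntegralFraction.isOpen_isTestFamily x₀ (y k) (q k)).inter
        (isOpen_iInter_of_finite fun k ↦ isOpen_iInter_of_finite fun j ↦
          isOpen_ne_fun (IntegralFraction.continuous_coord x₀ _).2 continuous_const))
  have hmem : ∀ F, F ∈ U' ↔ IsTestFamily r s (F.coordNum x₀) (F.coordDen x₀) y₀ p ∧
      (∀ k, IsTestFamily r s (F.coordNum x₀) (F.coordDen x₀) (y k) (q k)) ∧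
      ∀ k j, F.coordDen x₀ (y k, q k j) ≠ 0 := fun F ↦ by
    simp only [U', mem_inter_iff, mem_iInter, mem_ofPred_eq]
  -- Saturation is what makes the image of the open set `U'` open in the quotient topology.
  have hsat : ∀ F G : IntegralFraction g r s, F ≈ G → F ∈ U' → G ∈ U' := by
    intro F G hFG hF
    rw [hmem] at hF ⊢
    obtain ⟨h1, h2, h3⟩ := hF
    obtain ⟨c, hc, hcF⟩ := IntegralFraction.exists_coord_eq_mul hm hFG x₀ hy₀ h1
    refine ⟨h1.of_eq_mul hc hcF, fun k ↦ ?_, fun k j ↦ ?_⟩ <;>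
      obtain ⟨c, hc, hcF⟩ := IntegralFraction.exists_coord_eq_mul hm hFG x₀ (hy k) (h2 k)
    · exact (h2 k).of_eq_mul hc hcF
    · rw [(hcF _).2]
      exact mul_ne_zero hc (h3 k j)
  have hpre : π ⁻¹' (π '' U') = U' := by
    refine Subset.antisymm ?_ (subset_preimage_image π U')
    rintro G ⟨F, hF, hFG⟩
    exact hsat F G ((hrel F G).1 hFG) hF
  have hU : IsOpen (π '' U') := by rw [← hπ.isOpen_preimage, hpre]; exact hU'
  let idx : Fin (fracDim m r s ^ 2) ≃ Fin (fracDim m r s) × Fin (fracDim m r s) :=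
    (finCongr (sq _)).trans finProdFinEquiv.symm
  let val : IntegralFraction g r s → EuclideanSpace ℝ (Fin (fracDim m r s ^ 2)) := fun F ↦
    WithLp.toLp 2 fun i ↦ F.coordNum x₀ (y (idx i).1, q (idx i).1 (idx i).2) /
      F.coordDen x₀ (y (idx i).1, q (idx i).1 (idx i).2)
  have hval : ∀ F ∈ U', ∀ G ∈ U', val F = val G ↔ ∀ k j,
      F.coordNum x₀ (y k, q k j) * G.coordDen x₀ (y k, q k j) =
        G.coordNum x₀ (y k, q k j) * F.coordDen x₀ (y k, q k j) := by
    intro F hF G hG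
    have hF' := ((hmem F).1 hF).2.2
    have hG' := ((hmem G).1 hG).2.2
    constructor
    · intro h k j
      have := congrArg (fun v : EuclideanSpace ℝ (Fin (fracDim m r s ^ 2)) ↦ v (idx.symm (k, j))) h
      simp only [val, Equiv.apply_symm_apply] at this
      exact (div_eq_div_iff (hF' k j) (hG' k j)).1 this
    · intro h
      ext i
      exact (div_eq_div_iff (hF' _ _) (hG' _ _)).2 (h _ _)
  -- On `U'` the quotients depend only on the class, so an arbitrary choice of representatives does
  -- not spoil continuity.
  have hout : ∀ F ∈ U', val (Quotient.out (π F)) = val F := by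
    intro F hF
    have heq : F ≈ Quotient.out (π F) := Setoid.symm (Quotient.mk_out F)
    exact ((hval F hF _ (hsat _ _ heq hF)).2 fun k j ↦
      IntegralFraction.agreeAt_of_equiv heq x₀ (hy k) _).symm
  refine ⟨π '' U', hU, ⟨F₀, (hmem F₀).2 ⟨hp₀, hq₀, hQ₀⟩, rfl⟩, fun a ↦ val (Quotient.out a), ?_, ?_⟩
  · rw [hπ.continuousOn_isOpen_iff hU, hpre]
    have hcont : ContinuousOn val U' := by
      refine (PiLp.continuous_toLp 2 _).comp_continuousOn (continuousOn_pi.2 fun i ↦ ?_)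
      exact (IntegralFraction.continuous_coord x₀ _).1.continuousOn.div
        (IntegralFraction.continuous_coord x₀ _).2.continuousOn
        fun F hF ↦ ((hmem F).1 hF).2.2 _ _
    exact hcont.congr hout
  · rintro _ ⟨F, hF, rfl⟩ _ ⟨G, hG, rfl⟩ h
    have hFG : val F = val G := (hout F hF).symm.trans (h.trans (hout G hG))
    have hagree := hdet _ _ _ _ (F.isLocalIntegral x₀) (G.isLocalIntegral x₀)
      ((hmem F).1 hF).1 ((hmem F).1 hF).2.1 ((hval F hF G hG).1 hFG)
    obtain ⟨N, hNsub, hN, hyN⟩ := _root_.eventually_nhds_iff.1 hagree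
    refine (hrel F G).2 (F.equiv_of_agree_on_isOpen hm G (e.isOpen_inter_preimage hN)
      ⟨e.symm y₀, e.map_target hy₀, by rwa [mem_preimage, e.right_inv hy₀]⟩ fun x hx ↦ ?_)
    have := (F.agreeAt_iff G x₀ (e.map_source hx.1)).1 (hNsub _ hx.2)
    have hex : e.symm (e x) = x := e.left_inv hx.1
    change F.num.poly (e.symm (e x)) * G.den.poly (e.symm (e x)) =
      G.num.poly (e.symm (e x)) * F.den.poly (e.symm (e x)) at this
    rwa [hex] at this

end FiniteDimensionality

end

theorem theorem2 (m : ℕ) (hm : 1 ≤ m) (M : Type*) [TopologicalSpace M] [T2Space M]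
    [SecondCountableTopology M] [ConnectedSpace M] [ChartedSpace (EuclideanSpace ℝ (Fin m)) M]
    [IsManifold (𝓡 m) ∞ M] (g : PseudoRiemannianMetric m M) (r s : ℕ) :
    DimensionAtMost (RationalIntegrals g r s)
      (((r + m - 1).choose r + (s + m - 1).choose s - 1) ^ 2) := by
  exact dimensionAtMost_rationalIntegrals hm
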